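/- **Conventions.** $\mathbb N=\{1,2,\dots\}$. For $n\in\mathbb N$ and an integer $m\ge 0$, let $\mathbb F_{n,m}$ be the set of bit strings $((x_{n-1},\dots,x_0),(x_{-1},\dots,x_{-m}))$, let $\mathbb K_{n,m}=[-2^{n-1},2^{n-1}-2^{-m}]\cap 2^{-m}\mathbb Z$, let $\mathrm D_{n,m}:\mathbb F_{n,m}\to\mathbb K_{n,m}$, $\mathrm D_{n,m}(x)=-x_{n-1}2^{n-1}+\sum_{k=-m}^{n-2}x_k2^k$, be the two's complement decoder, and let $\mathrm E_{n,m}:\mathbb K_{n,m}\to\mathbb F_{n,m}$ be the two's complement encoder, which determines the bits greedily from the most significant one on (it is the inverse of $\mathrm D_{n,m}$). For $x\in\mathbb F_{n_1,m_1}$, $y\in\mathbb F_{n_2,m_2}$ put $x\boxplus y=\mathrm E_{\max\{n_1,n_2\}+1,\max\{m_1,m_2\}}(\mathrm D(x)+\mathrm D(y))$ and $x\boxdot y=\mathrm E_{n_1+n_2,m_1+m_2}(\mathrm D(x)\cdot\mathrm D(y))$; iterated sums $\boxplus$ are formed from left to right. A string $x\in\mathbb F_{n,m}$ is stored as the computational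 basis state $|x\rangle_{n+m}=|x_{n-1}\rangle\cdots|x_{-m}\rangle$, and $|0\rangle_r=|0\rangle\cdots|0\rangle$ ($r$ qubits). The elementary gates are $X,Y,Z,H,S,T$, $R_x(\theta),R_y(\theta),R_z(\theta)$ with $\theta\in(0,4\pi)$, $P(\phi)=\mathrm{diag}(1,e^{\mathrm i\phi})$ with $\phi\in(0,2\pi)$, $\mathrm{CNOT}$ and $\mathrm{SWAP}$. A quantum circuit on $N$ qubits is a finite product of $2^N\times 2^N$ matrices, each of the form $G_1\otimes\cdots\otimes G_r$ with every $G_j$ an elementary gate or the one-qubit identity; its number of elementary gates is the total number of factors $G_j$ that are elementary gates. **Proposition.** Let $d,n_1,n_2,m_1,m_2,K,I_1,\dots,I_K\in\mathbb N$, $\xi_1,\dots,\xi_K\in\{-1,1\}$ and $s\in(0,1)$. Put $n=n_1+n_2$, $m=m_1+m_2$ and $p=d(2n_2+2m_2+3)+(n_2+m_2)+(d-1)(n+m)$. Let $a_{k,l,j},b_{k,l}\in\mathbb F_{n_2,m_2}$ for $k=1,\dots,K$, $l=1,\dots,I_k$, $j=1,\dots,d$. For $\boldsymbol i=(i_1,\dots,i_d)\in\mathbb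 F_{n_1,m_1}^d$ define $$h_{k,l}(\boldsymbol i)=\Big(\mathop{\boxplus}_{j=1}^d(a_{k,l,j}\boxdot i_j)\Big)\boxplus b_{k,l}\in\mathbb F_{n+d,m},\qquad \boldsymbol h_k(\boldsymbol i)=\mathrm E_{n+d,m}\Big(\max_{1\le l\le I_k}\mathrm D_{n+d,m}(h_{k,l}(\boldsymbol i))\Big)\in\mathbb F_{n+d,m},$$ $$\boldsymbol h(\boldsymbol i)=\mathop{\boxplus}_{k=1}^K\big(\mathrm E_{2,0}(\xi_k)\boxdot\boldsymbol h_k(\boldsymbol i)\big)\in\mathbb F_{n+d+K+1,m}.$$ Let $f(x)=sx+\frac{\pi}{2}$ and $\bar f=f\circ\mathrm D_{n+d+K+1,m}$. Put $q_k=I_k(n+m+d+p)+(I_k-2)(n+m+d)+4(I_k-1)$ and $$N=d(n_1+m_1)+\sum_{k=1}^Kq_k+2K(n+m+d+5).$$ Then $N\le 23K\max_k\{I_k\}\,d\,(n+m+1)$, and there is a quantum circuit $\mathcal R_{\boldsymbol h}$ on $N$ qubits with at most $15262\,K^3\max_k\{I_k\}^3d^4(n+m+1)^4$ elementary gates such that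 for every $\boldsymbol i\in\mathbb F_{n_1,m_1}^d$ $$\mathcal R_{\boldsymbol h}:\ |i_1\rangle_{n_1+m_1}\cdots|i_d\rangle_{n_1+m_1}|0\rangle_{A+1}\ \mapsto\ |i_1\rangle_{n_1+m_1}\cdots|i_d\rangle_{n_1+m_1}|\mathrm{anc}\rangle_{A}\Big[\cos\big(\bar f(\boldsymbol h(\boldsymbol i))/2\big)|0\rangle+\sin\big(\bar f(\boldsymbol h(\boldsymbol i))/2\big)|1\rangle\Big],$$ where $A=q_1+\cdots+q_K+2K(n+m+d+5)-1$ and $|\mathrm{anc}\rangle_A$ is a computational basis state of $A$ ancilla qubits, which may depend on $\boldsymbol i$. -/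

import Mathlib

namespace PayoffCircuit

noncomputable section

/-! # Quantum circuits over an elementary gate set -/

/-- The elementary one-qubit gates. -/
inductive Gate1 : Type
  | X | Y | Z | H | S | T
  | Rx (θ : ℝ) (hθ : θ ∈ Set.Ioo 0 (4 * Real.pi))
  | Ry (θ : ℝ) (hθ : θ ∈ Set.Ioo 0 (4 * Real.pi))
  | Rz (θ : ℝ) (hθ : θ ∈ Set.Ioo 0 (4 * Real.pi))
  | P (φ : ℝ) (hφ : φ ∈ Set.Ioo 0 (2 * Real.pi))

/-- The elementary two-qubit gates. -/
inductive Gate2 : Type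
  | CNOT | SWAP

/-- The phase shift matrix `P(φ)`. -/
def phaseMatrix (φ : ℝ) : Matrix (Fin 2) (Fin 2) ℂ :=
  !![1, 0; 0, Complex.exp (Complex.I * φ)]

/-- The unitary matrix of a one-qubit gate. -/
def Gate1.matrix : Gate1 → Matrix (Fin 2) (Fin 2) ℂ
  | .X => !![0, 1; 1, 0]
  | .Y => !![0, -Complex.I; Complex.I, 0]
  | .Z => !![1, 0; 0, -1]
  | .H => (1 / (Real.sqrt 2 : ℂ)) • !![1, 1; 1, -1]
  | .S => phaseMatrix (Real.pi / 2)
  | .T => phaseMatrix (Real.pi / 4)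
  | .Rx θ _ =>
      !![(Real.cos (θ / 2) : ℂ), -Complex.I * Real.sin (θ / 2);
         -Complex.I * Real.sin (θ / 2), (Real.cos (θ / 2) : ℂ)]
  | .Ry θ _ =>
      !![(Real.cos (θ / 2) : ℂ), -(Real.sin (θ / 2) : ℂ);
         (Real.sin (θ / 2) : ℂ), (Real.cos (θ / 2) : ℂ)]
  | .Rz θ _ =>
      !![Complex.exp (-Complex.I * θ / 2), 0; 0, Complex.exp (Complex.I * θ / 2)]
  | .P φ _ => phaseMatrix φ

/-- The `4 × 4` unitary matrix of a two-qubit gate, in the ordered basis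
`|00⟩, |01⟩, |10⟩, |11⟩`. -/
def Gate2.matrix : Gate2 → Matrix (Fin 4) (Fin 4) ℂ
  | .CNOT => !![1, 0, 0, 0; 0, 1, 0, 0; 0, 0, 0, 1; 0, 0, 1, 0]
  | .SWAP => !![1, 0, 0, 0; 0, 0, 1, 0; 0, 1, 0, 0; 0, 0, 0, 1]

/-- The position `2 x + y` of the basis vector `|x y⟩` in the ordered basis
`|00⟩, |01⟩, |10⟩, |11⟩`. -/
def pairIndex (x y : Fin 2) : Fin 4 := ⟨2 * x.val + y.val, by omega⟩

/-- A layer `G₁ ⊗ G₂ ⊗ ⋯` of a circuit on `n` qubits: each factor is an elementary gate or a wire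
(the identity of one qubit), and the factors act on consecutive qubits, from the first one on. -/
inductive Layer : ℕ → Type
  | nil : Layer 0
  | wire {n : ℕ} (rest : Layer n) : Layer (n + 1)
  | gate1 {n : ℕ} (g : Gate1) (rest : Layer n) : Layer (n + 1)
  | gate2 {n : ℕ} (g : Gate2) (rest : Layer n) : Layer (n + 2)

/-- The entries of the Kronecker product of the factors of a layer. Rows and columns are indexed by
bit strings; the first qubit is the leftmost tensor factor. -/
def Layer.entry : {n : ℕ} → Layer n → (Fin n → Fin 2) → (Fin n → Fin 2) → ℂ
  | _, .nil, _, _ => 1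
  | _, .wire L, x, y =>
      (1 : Matrix (Fin 2) (Fin 2) ℂ) (x 0) (y 0) * L.entry (Fin.tail x) (Fin.tail y)
  | _, .gate1 g L, x, y => g.matrix (x 0) (y 0) * L.entry (Fin.tail x) (Fin.tail y)
  | _, .gate2 g L, x, y =>
      g.matrix (pairIndex (x 0) (x 1)) (pairIndex (y 0) (y 1)) *
        L.entry (Fin.tail (Fin.tail x)) (Fin.tail (Fin.tail y))

/-- The matrix of a layer, in the computational basis. -/
def Layer.matrix {n : ℕ} (L : Layer n) : Matrix (Fin n → Fin 2) (Fin n → Fin 2) ℂ :=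
  Matrix.of L.entry

/-- The number of elementary gates of a layer (wires are free). -/
def Layer.gateCount : {n : ℕ} → Layer n → ℕ
  | _, .nil => 0
  | _, .wire L => L.gateCount
  | _, .gate1 _ L => L.gateCount + 1
  | _, .gate2 _ L => L.gateCount + 1

/-- A quantum circuit on `n` qubits: a finite sequence of layers, the first one applied first. -/
abbrev Circuit (n : ℕ) : Type := List (Layer n)

/-- The matrix of a circuit with layers `L₁, …, L_r` is the product `L_r ⋯ L₂ L₁`. -/
def Circuit.matrix {n : ℕ} : Circuit n → Matrix (Fin n → Fin 2) (Fin n → Fin 2) ℂ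
  | [] => 1
  | L :: C => Circuit.matrix C * L.matrix

/-- The number of elementary gates of a circuit. -/
def Circuit.gateCount {n : ℕ} (C : Circuit n) : ℕ := (C.map Layer.gateCount).sum

/-! # Qubit states -/

/-- The state space `(ℂ²)^{⊗ n}`, by coordinates in the computational basis. -/
abbrev QState (n : ℕ) : Type := (Fin n → Fin 2) → ℂ

/-- The computational basis vector `|x⟩`. -/
def ket {n : ℕ} (x : Fin n → Fin 2) : QState n := Pi.single x 1

/-- The basis vector `|0⟩ ⋯ |0⟩` on `n` qubits. -/
def ketZero (n : ℕ) : QState n := ket (fun _ => 0)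

/-- The tensor product of two states; the first one occupies the first qubits. -/
def tensor {a b : ℕ} (v : QState a) (w : QState b) : QState (a + b) :=
  fun x => v (fun i => x (Fin.castAdd b i)) * w (fun j => x (Fin.natAdd a j))

/-- The basis vector `|i₁⟩ ⋯ |i_d⟩` of `d` consecutive registers of `w` qubits each. Qubit `t` of
register `j` is qubit `w * j + t` of the whole (all counted from `0`). -/
def ketRegisters {d w : ℕ} (i : Fin d → Fin w → Fin 2) : QState (d * w) :=
  ket (fun r => i (finProdFinEquiv.symm r).1 (finProdFinEquiv.symm r).2)

/-- The one-qubit state `α |0⟩ + β |1⟩`. -/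
def qubit (α β : ℂ) : QState 1 := α • ket ![0] + β • ket ![1]

end

/-! # Two's complement arithmetic -/

/-- The `(n, m)`-bit strings `((x_{n-1}, …, x_0), (x_{-1}, …, x_{-m}))`, written as one string with
the most significant bit first: position `t` holds the bit `x_{n-1-t}`. -/
abbrev BitStr (n m : ℕ) : Type := Fin (n + m) → Fin 2

/-- The signed weight of position `t`: `-2^{n-1}` for the leading bit, `2^{n-1-t}` for the others. -/
def weight (n t : ℕ) : ℚ :=
  if t = 0 then -(2 : ℚ) ^ ((n : ℤ) - 1) else (2 : ℚ) ^ ((n : ℤ) - 1 - (t : ℤ))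

/-- The decoder `D_{n,m}`: `x ↦ -x_{n-1} 2^{n-1} + ∑_{k=-m}^{n-2} x_k 2^k`. -/
def decode {n m : ℕ} (x : BitStr n m) : ℚ := ∑ t : Fin (n + m), ((x t).val : ℚ) * weight n t

/-- Whether the encoder sets the bit at position `t`, when the bits before it have the value `v`. -/
def encodeTest (n : ℕ) (y : ℚ) (t : ℕ) (v : ℚ) : Bool :=
  if t = 0 then decide (y < 0) else decide (v + weight n t ≤ y)

/-- The value of the first `t` bits that the encoder produces. -/
def encodeValue (n : ℕ) (y : ℚ) : ℕ → ℚ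
  | 0 => 0
  | t + 1 => encodeValue n y t + if encodeTest n y t (encodeValue n y t) then weight n t else 0

/-- The encoder `E_{n,m}`: the leading bit records the sign of `y`, and each further bit is set if
and only if the value of the bits so far plus the weight of the new bit does not exceed `y`. It is
meant for `y ∈ [-2^{n-1}, 2^{n-1} - 2^{-m}] ∩ 2^{-m} ℤ`. -/
def encode (n m : ℕ) (y : ℚ) : BitStr n m :=
  fun t => if encodeTest n y t (encodeValue n y t) then 1 else 0

/-- Two's complement addition `F_{n₁,m₁} × F_{n₂,m₂} → F_{max n₁ n₂ + 1, max m₁ m₂}`. -/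
def boxplus {n₁ m₁ n₂ m₂ n m : ℕ} (x : BitStr n₁ m₁) (y : BitStr n₂ m₂)
    (_hn : n = max n₁ n₂ + 1) (_hm : m = max m₁ m₂) : BitStr n m :=
  encode n m (decode x + decode y)

/-- Two's complement multiplication `F_{n₁,m₁} × F_{n₂,m₂} → F_{n₁ + n₂, m₁ + m₂}`. -/
def boxdot {n₁ m₁ n₂ m₂ n m : ℕ} (x : BitStr n₁ m₁) (y : BitStr n₂ m₂)
    (_hn : n = n₁ + n₂) (_hm : m = m₁ + m₂) : BitStr n m :=
  encode n m (decode x * decode y)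

/-- The iterated sum `((c₁ ⊞ c₂) ⊞ c₃) ⊞ ⋯ ⊞ c_r` in `F_{n+r-1,m}` of `r ≥ 1` strings in `F_{n,m}`
(for `r = 0` the value is irrelevant). -/
def bigBoxplus {n m : ℕ} : {r : ℕ} → (Fin r → BitStr n m) → BitStr (n + r - 1) m
  | 0, _ => fun _ => 0
  | 1, c => c 0
  | r + 2, c =>
      boxplus (bigBoxplus (fun j : Fin (r + 1) => c j.castSucc)) (c (Fin.last (r + 1)))
        (by omega) (by omega)

/-- The maximum `M_{r,n,m}(x₁, …, x_r) = E_{n,m}(max {D_{n,m}(x₁), …, D_{n,m}(x_r)})`. -/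
def maxStr {n m r : ℕ} (hr : 1 ≤ r) (x : Fin r → BitStr n m) : BitStr n m :=
  encode n m (Finset.univ.sup' ⟨⟨0, hr⟩, Finset.mem_univ _⟩ fun l => decode (x l))

/-- The affine function `(⊞_j (a_j ⊡ i_j)) ⊞ b` with values in `F_{n₁+n₂+d, m₁+m₂}`. -/
def affineStr {d n₁ n₂ m₁ m₂ : ℕ} (hd : 1 ≤ d) (a : Fin d → BitStr n₂ m₂) (b : BitStr n₂ m₂)
    (i : Fin d → BitStr n₁ m₁) : BitStr (n₁ + n₂ + d) (m₁ + m₂) :=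
  boxplus
    (bigBoxplus fun j =>
      (boxdot (a j) (i j) (by omega) (by omega) : BitStr (n₁ + n₂) (m₁ + m₂)))
    b (by omega) (by omega)

/-- The encoded payoff `⊞_k (E_{2,0}(ξ_k) ⊡ max_l ((⊞_j (a_{k,l,j} ⊡ i_j)) ⊞ b_{k,l}))`
with values in `F_{n+d+K+1,m}`, where `n = n₁ + n₂` and `m = m₁ + m₂`. -/
def payoffStr {d n₁ n₂ m₁ m₂ K : ℕ} {I : Fin K → ℕ} (hd : 1 ≤ d) (hI : ∀ k, 1 ≤ I k)
    (ξ : Fin K → ℤ) (a : (k : Fin K) → Fin (I k) → Fin d → BitStr n₂ m₂)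
    (b : (k : Fin K) → Fin (I k) → BitStr n₂ m₂) (i : Fin d → BitStr n₁ m₁) :
    BitStr (n₁ + n₂ + d + K + 1) (m₁ + m₂) :=
  fun t =>
    (bigBoxplus fun k =>
      (boxdot (encode 2 0 (ξ k)) (maxStr (hI k) fun l => affineStr hd (a k l) (b k l) i)
        (by omega) (by omega) : BitStr (n₁ + n₂ + d + 2) (m₁ + m₂)))
      (Fin.cast (by omega) t)

/-! # The number of qubits -/

/-- `p = d (2 n₂ + 2 m₂ + 3) + (n₂ + m₂) + (d - 1) (n + m)`, where `n = n₁ + n₂`, `m = m₁ + m₂`. -/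
def pCount (d n₁ n₂ m₁ m₂ : ℤ) : ℤ :=
  d * (2 * n₂ + 2 * m₂ + 3) + (n₂ + m₂) + (d - 1) * ((n₁ + n₂) + (m₁ + m₂))

/-- `q = r (n + m + d + p) + (r - 2) (n + m + d) + 4 (r - 1)`. -/
def qCount (d n₁ n₂ m₁ m₂ r : ℤ) : ℤ :=
  r * ((n₁ + n₂) + (m₁ + m₂) + d + pCount d n₁ n₂ m₁ m₂) +
    (r - 2) * ((n₁ + n₂) + (m₁ + m₂) + d) + 4 * (r - 1)

/-- `N = d (n₁ + m₁) + ∑_k q_k + 2 K (n + m + d + 5)`. -/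
def qubitCount (d n₁ n₂ m₁ m₂ : ℤ) {K : ℕ} (I : Fin K → ℕ) : ℤ :=
  d * (n₁ + m₁) + ∑ k, qCount d n₁ n₂ m₁ m₂ (I k) +
    2 * (K : ℤ) * ((n₁ + n₂) + (m₁ + m₂) + d + 5)

end PayoffCircuit

namespace PayoffCircuit

noncomputable section

open Function

/-! # Circuits acting on basis states -/

/-! Two's complement sums and products are given enough bits never to overflow, so decoding turns
`boxplus` and `boxdot` into exact arithmetic (`decode_boxplus`, `decode_boxdot`), and the payoff
decodes to ∑_k ξ_k max_l D(h_{k,l}(i)) (`decode_payoffStr`). After scaling by 2^m, each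
D(h_{k,l}(i)) is an affine function of the input bits with integer coefficients
(`intDecode_affineStr`). As the value of a string in F_{n+d,m} it lies in [-2^u, 2^u), where u + 1 =
n + m + d. The circuit therefore need not imitate the string operations; it only has to reproduce
these integers.

The maxima are computed by a reversible program of NOT, CNOT and Toffoli gates, with one register of
u + 2 bits for each pair (k, l). An affine function is accumulated by adding its coefficients as
constants, each controlled by one input bit (`run_addProg`). A running maximum M absorbs a new value
v by forming D = v - M in a fresh register and adding D to M when D ≥ 0 (`run_maxProg`). The
registers D are never uncomputed: the ancillas may end in any basis state, even one that depends on
the input.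

The signs ξ_k and the sum over k never enter a register. Rotations R_y of one qubit add their
angles, so each bit of the k-th maximum controls a rotation by s ξ_k 2^{-m} times its place value,
and a last rotation by π/2 completes the angle (`rotatesBy_controlled`, `exists_circuit_payoff`).

For the count, two-qubit gates act on neighbours only, so a distant CNOT is carried by SWAPs and a
Toffoli gate costs at most 12N + 15. With J = max I_k and P = d(n+m+1), the program has O(KJP³)
gates and N ≤ 23KJP, hence O(K²J²P⁴) elementary gates in all (`gateCount_bound`). -/

theorem mulVec_ket {n : ℕ} (M : Matrix (Fin n → Fin 2) (Fin n → Fin 2) ℂ) (x : Fin n → Fin 2) :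
    M.mulVec (ket x) = fun y => M y x := by
  unfold ket
  rw [Matrix.mulVec_single_one]
  rfl

theorem ket_apply {n : ℕ} (x y : Fin n → Fin 2) : ket x y = if y = x then 1 else 0 := by
  unfold ket
  rw [Pi.single_apply]

theorem Circuit.matrix_append {n : ℕ} (C D : Circuit n) :
    Circuit.matrix (C ++ D) = Circuit.matrix D * Circuit.matrix C := by
  induction C with
  | nil => simp [Circuit.matrix]
  | cons L C ih => simp [Circuit.matrix, ih, Matrix.mul_assoc]

theorem Circuit.gateCount_append {n : ℕ} (C D : Circuit n) :
    Circuit.gateCount (C ++ D) = Circuit.gateCount C + Circuit.gateCount D := by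
  simp [Circuit.gateCount]

/-- The layer consisting of wires only. -/
def Layer.wires : (n : ℕ) → Layer n
  | 0 => .nil
  | n + 1 => .wire (Layer.wires n)

theorem Layer.gateCount_wires (n : ℕ) : (Layer.wires n).gateCount = 0 := by
  induction n with
  | zero => rfl
  | succ n ih => simpa [Layer.wires, Layer.gateCount] using ih

theorem Layer.entry_wires {n : ℕ} (y x : Fin n → Fin 2) :
    (Layer.wires n).entry y x = if ∀ r, y r = x r then 1 else 0 := by
  induction n with
  | zero => simp [Layer.wires, Layer.entry]
  | succ n ih =>
    rw [if_congr (Fin.forall_fin_succ (P := fun r => y r = x r)) rfl rfl, Layer.wires, Layer.entry,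
      ih, Matrix.one_apply]
    by_cases h0 : y 0 = x 0
    · simp only [h0, true_and, if_true, one_mul]; rfl
    · simp only [h0, false_and, if_false, zero_mul]

theorem exists_layer_gate1 (g : Gate1) {n : ℕ} (t : Fin n) :
    ∃ L : Layer n, L.gateCount = 1 ∧ ∀ y x,
      L.entry y x = g.matrix (y t) (x t) * if ∀ r, r ≠ t → y r = x r then 1 else 0 := by
  induction n with
  | zero => exact t.elim0
  | succ n ih =>
    refine Fin.cases ?_ (fun t => ?_) t
    · refine ⟨.gate1 g (Layer.wires n), by simp [Layer.gateCount, Layer.gateCount_wires], ?_⟩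
      intro y x
      have key : (∀ r, r ≠ (0 : Fin (n + 1)) → y r = x r) ↔ ∀ r, Fin.tail y r = Fin.tail x r := by
        simp [Fin.forall_fin_succ, Fin.tail]
      rw [if_congr key rfl rfl, Layer.entry, Layer.entry_wires]
    · obtain ⟨L, hL, h⟩ := ih t
      refine ⟨.wire L, by simpa [Layer.gateCount] using hL, ?_⟩
      intro y x
      have key : (∀ r, r ≠ t.succ → y r = x r) ↔
          y 0 = x 0 ∧ ∀ r, r ≠ t → Fin.tail y r = Fin.tail x r := by
        simp [Fin.forall_fin_succ, Fin.tail, (Fin.succ_ne_zero t).symm]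
      rw [if_congr key rfl rfl, Layer.entry, h, Matrix.one_apply]
      by_cases h0 : y 0 = x 0
      · simp only [h0, true_and, if_true, one_mul]; rfl
      · simp only [h0, false_and, if_false, zero_mul, mul_zero]

theorem exists_layer_gate2 (g : Gate2) {n : ℕ} (t : Fin n) :
    ∃ L : Layer (n + 1), L.gateCount = 1 ∧ ∀ y x,
      L.entry y x = g.matrix (pairIndex (y t.castSucc) (y t.succ))
        (pairIndex (x t.castSucc) (x t.succ)) *
        if ∀ r, r ≠ t.castSucc → r ≠ t.succ → y r = x r then 1 else 0 := by
  induction n with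
  | zero => exact t.elim0
  | succ n ih =>
    refine Fin.cases ?_ (fun t => ?_) t
    · refine ⟨.gate2 g (Layer.wires n), by simp [Layer.gateCount, Layer.gateCount_wires], ?_⟩
      intro y x
      have key : (∀ r, r ≠ (0 : Fin (n + 1)).castSucc → r ≠ (0 : Fin (n + 1)).succ → y r = x r) ↔
          ∀ r, Fin.tail (Fin.tail y) r = Fin.tail (Fin.tail x) r := by
        have h1 : ∀ r : Fin n, r.succ.succ ≠ (1 : Fin (n + 2)) := fun r h => by
          simp [Fin.ext_iff] at h
        simp [Fin.forall_fin_succ, Fin.tail, h1]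
      rw [if_congr key rfl rfl, Layer.entry, Layer.entry_wires]
      rfl
    · obtain ⟨L, hL, h⟩ := ih t
      refine ⟨.wire L, by simpa [Layer.gateCount] using hL, ?_⟩
      intro y x
      have key : (∀ r, r ≠ t.succ.castSucc → r ≠ t.succ.succ → y r = x r) ↔
          y 0 = x 0 ∧ ∀ r, r ≠ t.castSucc → r ≠ t.succ → Fin.tail y r = Fin.tail x r := by
        rw [Fin.forall_fin_succ]
        simp [Fin.tail, (Fin.succ_ne_zero _).symm]
      rw [if_congr key rfl rfl, Layer.entry, h, Matrix.one_apply]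
      by_cases h0 : y 0 = x 0
      · simp only [h0, true_and, if_true, one_mul]; rfl
      · simp only [h0, false_and, if_false, zero_mul, mul_zero]

/-- `f` gives the images of the basis vectors under some circuit with at most `c` gates. -/
def Realizes {n : ℕ} (c : ℕ) (f : (Fin n → Fin 2) → QState n) : Prop :=
  ∃ C : Circuit n, C.gateCount ≤ c ∧ ∀ x, C.matrix.mulVec (ket x) = f x

theorem Realizes.mono {n c c' : ℕ} {f : (Fin n → Fin 2) → QState n} (h : Realizes c f)
    (hc : c ≤ c') : Realizes c' f := by
  obtain ⟨C, h1, h2⟩ := h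
  exact ⟨C, h1.trans hc, h2⟩

theorem Realizes.congr {n c : ℕ} {f g : (Fin n → Fin 2) → QState n} (h : Realizes c f)
    (hfg : ∀ x, f x = g x) : Realizes c g := by
  obtain ⟨C, h1, h2⟩ := h
  exact ⟨C, h1, fun x => (h2 x).trans (hfg x)⟩

theorem Realizes.id {n : ℕ} (c : ℕ) : Realizes (n := n) c ket :=
  ⟨[], by simp [Circuit.gateCount], fun x => by simp [Circuit.matrix]⟩

/-- Scalars are carried along because the diagonal gates inside the Toffoli circuit map a basis
vector to a multiple of a basis vector; along a composition these phases multiply. -/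
theorem Realizes.comp {n c c' : ℕ} {δ δ' : (Fin n → Fin 2) → ℂ}
    {φ φ' : (Fin n → Fin 2) → Fin n → Fin 2}
    (h : Realizes c fun x => δ x • ket (φ x)) (h' : Realizes c' fun x => δ' x • ket (φ' x)) :
    Realizes (c + c') fun x => (δ x * δ' (φ x)) • ket (φ' (φ x)) := by
  obtain ⟨C, h1, h2⟩ := h
  obtain ⟨C', h1', h2'⟩ := h'
  refine ⟨C ++ C', by rw [Circuit.gateCount_append]; omega, fun x => ?_⟩
  rw [Circuit.matrix_append, ← Matrix.mulVec_mulVec, h2, Matrix.mulVec_smul, h2', smul_smul]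

theorem Realizes.comp_ket {n c c' : ℕ} {φ φ' : (Fin n → Fin 2) → Fin n → Fin 2}
    (h : Realizes c fun x => ket (φ x)) (h' : Realizes c' fun x => ket (φ' x)) :
    Realizes (c + c') fun x => ket (φ' (φ x)) := by
  obtain ⟨C, h1, h2⟩ := h
  obtain ⟨C', h1', h2'⟩ := h'
  refine ⟨C ++ C', by rw [Circuit.gateCount_append]; omega, fun x => ?_⟩
  rw [Circuit.matrix_append, ← Matrix.mulVec_mulVec, h2, h2']

theorem Realizes.with_one {n c : ℕ} {φ : (Fin n → Fin 2) → Fin n → Fin 2}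
    (h : Realizes c fun x => ket (φ x)) : Realizes c fun x => (1 : ℂ) • ket (φ x) :=
  h.congr fun x => by simp

theorem Layer.realizes {n : ℕ} (L : Layer n) : Realizes L.gateCount fun x y => L.entry y x := by
  refine ⟨[L], by simp [Circuit.gateCount], fun x => ?_⟩
  rw [mulVec_ket]
  simp [Circuit.matrix, Layer.matrix]

theorem realizes_gate1 {n : ℕ} (g : Gate1) (t : Fin n) :
    Realizes 1 fun x => g.matrix 0 (x t) • ket (update x t 0) +
      g.matrix 1 (x t) • ket (update x t 1) := by
  obtain ⟨L, hL, h⟩ := exists_layer_gate1 g t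
  refine (hL ▸ L.realizes).congr fun x => ?_
  funext y
  simp only [h, Pi.add_apply, Pi.smul_apply, ket_apply, eq_update_iff, smul_eq_mul]
  have : y t = 0 ∨ y t = 1 := by omega
  rcases this with h0 | h0 <;> simp [h0]

theorem fin2_cases (a : Fin 2) : a = 0 ∨ a = 1 := by omega

theorem realizes_swap_adjacent {n : ℕ} (t : Fin n) :
    Realizes 1 fun x : Fin (n + 1) → Fin 2 => ket (x ∘ Equiv.swap t.castSucc t.succ) := by
  obtain ⟨L, hL, h⟩ := exists_layer_gate2 .SWAP t
  refine (hL ▸ L.realizes).congr fun x => ?_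
  have hne : t.castSucc ≠ t.succ := (Fin.castSucc_lt_succ).ne
  funext y
  simp only [h, ket_apply]
  have key : y = x ∘ Equiv.swap t.castSucc t.succ ↔ (y t.castSucc = x t.succ ∧
      y t.succ = x t.castSucc) ∧ ∀ r, r ≠ t.castSucc → r ≠ t.succ → y r = x r := by
    constructor
    · rintro rfl
      refine ⟨⟨by simp, by simp⟩, fun r h1 h2 => by simp [Equiv.swap_apply_of_ne_of_ne h1 h2]⟩
    · rintro ⟨⟨h1, h2⟩, h3⟩
      funext r
      by_cases hr : r = t.castSucc
      · subst hr; simp [h1]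
      by_cases hr' : r = t.succ
      · subst hr'; simp [h2]
      simp [Equiv.swap_apply_of_ne_of_ne hr hr', h3 r hr hr']
  simp only [key]
  rcases fin2_cases (y t.castSucc) with h1 | h1 <;> rcases fin2_cases (y t.succ) with h2 | h2 <;>
    rcases fin2_cases (x t.castSucc) with h3 | h3 <;> rcases fin2_cases (x t.succ) with h4 | h4 <;>
    simp [h1, h2, h3, h4, pairIndex, Gate2.matrix]

/-- The map of bit strings that adds bit `a` to bit `b`. -/
def flipBy {ι : Type*} [DecidableEq ι] (a b : ι) (x : ι → Fin 2) : ι → Fin 2 :=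
  update x b (x b + x a)

theorem realizes_cnot_adjacent {n : ℕ} (t : Fin n) :
    Realizes 1 fun x : Fin (n + 1) → Fin 2 => ket (flipBy t.castSucc t.succ x) := by
  obtain ⟨L, hL, h⟩ := exists_layer_gate2 .CNOT t
  refine (hL ▸ L.realizes).congr fun x => ?_
  have hne : t.castSucc ≠ t.succ := (Fin.castSucc_lt_succ).ne
  funext y
  simp only [h, ket_apply, flipBy]
  have key : y = update x t.succ (x t.succ + x t.castSucc) ↔ (y t.castSucc = x t.castSucc ∧
      y t.succ = x t.succ + x t.castSucc) ∧
        ∀ r, r ≠ t.castSucc → r ≠ t.succ → y r = x r := by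
    rw [eq_update_iff]
    constructor
    · rintro ⟨h1, h2⟩
      exact ⟨⟨h2 _ hne, h1⟩, fun r _ hr => h2 r hr⟩
    · rintro ⟨⟨h1, h2⟩, h3⟩
      refine ⟨h2, fun r hr => ?_⟩
      by_cases hr' : r = t.castSucc
      · subst hr'; exact h1
      · exact h3 r hr' hr
  simp only [key]
  rcases fin2_cases (y t.castSucc) with h1 | h1 <;> rcases fin2_cases (y t.succ) with h2 | h2 <;>
    rcases fin2_cases (x t.castSucc) with h3 | h3 <;> rcases fin2_cases (x t.succ) with h4 | h4 <;>
    simp [h1, h2, h3, h4, pairIndex, Gate2.matrix]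

theorem flipBy_comp_perm {n : ℕ} (σ : Equiv.Perm (Fin n)) (a b : Fin n) (x : Fin n → Fin 2) :
    flipBy a b (x ∘ σ) ∘ σ.symm = flipBy (σ a) (σ b) x := by
  funext r
  simp only [flipBy, comp_apply, update_apply]
  by_cases h : r = σ b
  · subst h; simp
  · rw [if_neg h, if_neg (fun h' => h (by rw [← h']; simp))]; simp

/-- Conjugation by an adjacent SWAP merely renames the wires, so control and target can be moved
apart one step at a time, at two gates per step. -/
theorem Realizes.cnot_conj {n c : ℕ} {a b : Fin (n + 1)}
    (h : Realizes c fun x => ket (flipBy a b x)) (t : Fin n) :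
    Realizes (c + 2) fun x => ket (flipBy (Equiv.swap t.castSucc t.succ a)
      (Equiv.swap t.castSucc t.succ b) x) := by
  have := ((realizes_swap_adjacent t).comp_ket h).comp_ket (realizes_swap_adjacent t)
  refine (this.mono (by omega)).congr fun x => ?_
  rw [← flipBy_comp_perm, Equiv.symm_swap]

theorem realizes_cnot_lt {n : ℕ} (k : ℕ) (a b : Fin (n + 1)) (h : a.val + k + 1 = b.val) :
    Realizes (2 * k + 1) fun x => ket (flipBy a b x) := by
  induction k generalizing a with
  | zero =>
    have := realizes_cnot_adjacent (n := n) ⟨a, by omega⟩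
    have e1 : (⟨a, by omega⟩ : Fin n).castSucc = a := rfl
    have e2 : (⟨a, by omega⟩ : Fin n).succ = b := Fin.ext (by simp; omega)
    rwa [e1, e2] at this
  | succ k ih =>
    have := (ih ⟨a + 1, by omega⟩ (by simp; omega)).cnot_conj (⟨a, by omega⟩ : Fin n)
    have e1 : (⟨a, by omega⟩ : Fin n).castSucc = a := rfl
    have e2 : (⟨a, by omega⟩ : Fin n).succ = ⟨a + 1, by omega⟩ := rfl
    rw [e1, e2, Equiv.swap_apply_right, Equiv.swap_apply_of_ne_of_ne (by omega)
      (by simp [Fin.ext_iff]; omega)] at this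
    exact this.mono (by omega)

/-- The elementary CNOT has its control on the left. In the base case one SWAP conjugation reverses
it, which explains the two gates more than in `realizes_cnot_lt`. -/
theorem realizes_cnot_gt {n : ℕ} (k : ℕ) (a b : Fin (n + 1)) (h : b.val + k + 1 = a.val) :
    Realizes (2 * k + 3) fun x => ket (flipBy a b x) := by
  induction k generalizing a with
  | zero =>
    have := (realizes_cnot_adjacent (n := n) ⟨b, by omega⟩).cnot_conj ⟨b, by omega⟩
    have e1 : (⟨b, by omega⟩ : Fin n).castSucc = b := rfl
    have e2 : (⟨b, by omega⟩ : Fin n).succ = a := Fin.ext (by simp; omega)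
    rwa [e1, e2, Equiv.swap_apply_right, Equiv.swap_apply_left] at this
  | succ k ih =>
    have := (ih ⟨a - 1, by omega⟩ (by simp; omega)).cnot_conj (⟨a - 1, by omega⟩ : Fin n)
    have e1 : (⟨a - 1, by omega⟩ : Fin n).castSucc = ⟨a - 1, by omega⟩ := rfl
    have e2 : (⟨a - 1, by omega⟩ : Fin n).succ = a := Fin.ext (by simp; omega)
    rw [e1, e2, Equiv.swap_apply_left, Equiv.swap_apply_of_ne_of_ne
      (by simp [Fin.ext_iff]; omega) (by omega)] at this
    exact this.mono (by omega)

theorem realizes_cnot {n : ℕ} {a b : Fin n} (h : a ≠ b) :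
    Realizes (2 * n + 1) fun x => ket (flipBy a b x) := by
  cases n with
  | zero => exact a.elim0
  | succ n =>
    rcases lt_or_gt_of_ne h with h | h
    · have h' : a.val < b.val := h
      exact (realizes_cnot_lt (b - a - 1) a b (by omega)).mono (by omega)
    · have h' : b.val < a.val := h
      exact (realizes_cnot_gt (a - b - 1) a b (by omega)).mono (by omega)

/-! # The Toffoli gate -/

theorem realizes_not {n : ℕ} (a : Fin n) : Realizes 1 fun x => ket (update x a (x a + 1)) := by
  refine (realizes_gate1 .X a).congr fun x => ?_
  rcases fin2_cases (x a) with h | h <;> simp [h, Gate1.matrix]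

theorem realizes_phase {n : ℕ} (g : Gate1) (φ : ℝ) (hg : g.matrix = phaseMatrix φ) (t : Fin n) :
    Realizes 1 fun x => (Complex.exp (Complex.I * φ) ^ (x t).val) • ket x := by
  refine (realizes_gate1 g t).congr fun x => ?_
  rcases fin2_cases (x t) with h | h <;> rw [hg] <;> simp [h, phaseMatrix] <;>
    rw [← h, update_eq_self]

theorem realizes_T {n : ℕ} (t : Fin n) :
    Realizes 1 fun x => (Complex.exp (Complex.I * (Real.pi / 4)) ^ (x t).val) • ket x := by
  refine (realizes_phase .T (Real.pi / 4) rfl t).congr fun x => ?_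
  simp

/-- The inverse of T is not elementary, but T has order 8, so T⁻¹ = T⁷ = P(7π/4). -/
theorem realizes_T_inv {n : ℕ} (t : Fin n) :
    Realizes 1 fun x => (Complex.exp (Complex.I * (Real.pi / 4)) ^ (7 * (x t).val)) • ket x := by
  have hφ : 7 * Real.pi / 4 ∈ Set.Ioo 0 (2 * Real.pi) :=
    ⟨by positivity, by linarith [Real.pi_pos]⟩
  refine (realizes_phase (.P _ hφ) _ rfl t).congr fun x => ?_
  simp only [← Complex.exp_nat_mul]
  congr 2
  push_cast
  ring

theorem exp_pi_div_four_pow : Complex.exp (Complex.I * (Real.pi / 4)) ^ 4 = -1 := by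
  rw [← Complex.exp_nat_mul, ← Complex.exp_pi_mul_I]
  push_cast
  ring_nf

/-- For bits, 4abc = a + b + c - (a⊕b) - (b⊕c) - (a⊕c) + (a⊕b⊕c). With ω = exp(iπ/4) and ω⁴ = -1,
the sign (-1)^{abc} is thus a product of powers ω^{±1} of parities. The CNOTs bring each parity onto
a wire where T or T⁻¹ reads it, and then undo it. Six CNOTs and seven phase gates cost 6(2n + 1) +
7. -/
theorem realizes_ccz {n : ℕ} {a b c : Fin n} (hab : a ≠ b) (hac : a ≠ c) (hbc : b ≠ c) :
    Realizes (12 * n + 13) fun x =>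
      ((-1 : ℂ) ^ ((x a).val * (x b).val * (x c).val)) • ket x := by
  have cab := (realizes_cnot hab).with_one
  have ccb := (realizes_cnot hbc.symm).with_one
  have cac := (realizes_cnot hac).with_one
  have := ((realizes_T a).comp <| (realizes_T b).comp <| (realizes_T c).comp <| cab.comp <|
    (realizes_T_inv b).comp <| ccb.comp <| (realizes_T b).comp <| cab.comp <|
    (realizes_T_inv b).comp <| ccb.comp <| cac.comp <| (realizes_T_inv c).comp cac)
  refine (this.mono (by omega)).congr fun x => ?_
  -- The CNOTs cancel, so only the phase remains.
  have hx : flipBy a c (flipBy a c (flipBy c b (flipBy a b (flipBy c b (flipBy a b x))))) = x := by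
    funext r
    simp only [flipBy, update_apply]
    split_ifs <;> simp_all <;> omega
  simp only [hx]
  congr 1
  have h4 := exp_pi_div_four_pow
  generalize Complex.exp (Complex.I * (Real.pi / 4)) = ω at h4
  have e1 : (flipBy a b x) b = x b + x a := by simp [flipBy]
  have e2 : (flipBy c b (flipBy a b x)) b = x b + x a + x c := by simp [flipBy, hbc.symm]
  have e3 : (flipBy a b (flipBy c b (flipBy a b x))) b = x b + x c := by
    simp [flipBy, hbc.symm, hab]; omega
  have e4 : (flipBy a c (flipBy c b (flipBy a b (flipBy c b (flipBy a b x))))) c = x c + x a := by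
    simp [flipBy, hbc.symm, hab]
  rw [e1, e2, e3, e4]
  have h8 : ω ^ 8 = 1 := by rw [show ω ^ 8 = (ω ^ 4) ^ 2 by ring, h4]; norm_num
  have h16 : ω ^ 16 = 1 := by rw [show ω ^ 16 = (ω ^ 4) ^ 4 by ring, h4]; norm_num
  rcases fin2_cases (x a) with h1 | h1 <;> rcases fin2_cases (x b) with h2 | h2 <;>
    rcases fin2_cases (x c) with h3 | h3 <;> simp [h1, h2, h3] <;> ring_nf <;>
    simp [h4, h16]

/-- The map of bit strings that adds the product of bits `a` and `b` to bit `c`. -/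
def flipByAnd {ι : Type*} [DecidableEq ι] (a b c : ι) (x : ι → Fin 2) : ι → Fin 2 :=
  update x c (x c + x a * x b)

/-- Conjugating the doubly controlled Z by a Hadamard gate on `c` turns the sign into a bit flip of
`c`. -/
theorem realizes_toffoli {n : ℕ} {a b c : Fin n} (hab : a ≠ b) (hac : a ≠ c) (hbc : b ≠ c) :
    Realizes (12 * n + 15) fun x => ket (flipByAnd a b c x) := by
  obtain ⟨C, h1, h2⟩ := realizes_ccz hab hac hbc
  obtain ⟨D, h1', h2'⟩ := realizes_gate1 .H c
  refine ⟨D ++ (C ++ D), by simp only [Circuit.gateCount_append]; omega, fun x => ?_⟩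
  rw [Circuit.matrix_append, Circuit.matrix_append, ← Matrix.mulVec_mulVec,
    ← Matrix.mulVec_mulVec, h2', Matrix.mulVec_add, Matrix.mulVec_smul, Matrix.mulVec_smul, h2, h2,
    Matrix.mulVec_add, Matrix.mulVec_smul, Matrix.mulVec_smul, Matrix.mulVec_smul,
    Matrix.mulVec_smul, h2', h2']
  have hs : ((Real.sqrt 2 : ℝ) : ℂ)⁻¹ * ((Real.sqrt 2 : ℝ) : ℂ)⁻¹ = 1 / 2 := by
    rw [← mul_inv, ← Complex.ofReal_mul, Real.mul_self_sqrt (by norm_num)]; norm_num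
  funext y
  simp only [update_self, update_idem, update_of_ne hac, update_of_ne hbc, flipByAnd]
  rcases fin2_cases (x a) with e1 | e1 <;> rcases fin2_cases (x b) with e2 | e2 <;>
    rcases fin2_cases (x c) with e3 | e3 <;> simp [e1, e2, e3, Gate1.matrix] <;>
    ring_nf <;> simp only [pow_two, hs] <;> ring

/-! # Controlled rotations of one qubit -/

/-- The basis state `|x⟩` with qubit `t` replaced by `cos (θ / 2) |0⟩ + sin (θ / 2) |1⟩`. -/
def rotState {n : ℕ} (t : Fin n) (x : Fin n → Fin 2) (θ : ℝ) : QState n :=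
  (Real.cos (θ / 2) : ℂ) • ket (update x t 0) + (Real.sin (θ / 2) : ℂ) • ket (update x t 1)

/-- Some circuit with at most `c` gates increases the angle of qubit `t` by `f`. -/
def RotatesBy {n : ℕ} (c : ℕ) (t : Fin n) (f : (Fin n → Fin 2) → ℝ) : Prop :=
  ∃ C : Circuit n, C.gateCount ≤ c ∧
    ∀ x θ, C.matrix.mulVec (rotState t x θ) = rotState t x (θ + f x)

theorem RotatesBy.comp {n c c' : ℕ} {t : Fin n} {f g : (Fin n → Fin 2) → ℝ}
    (h : RotatesBy c t f) (h' : RotatesBy c' t g) :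
    RotatesBy (c + c') t fun x => f x + g x := by
  obtain ⟨C, h1, h2⟩ := h
  obtain ⟨C', h1', h2'⟩ := h'
  refine ⟨C ++ C', by rw [Circuit.gateCount_append]; omega, fun x θ => ?_⟩
  rw [Circuit.matrix_append, ← Matrix.mulVec_mulVec, h2, h2', add_assoc]

theorem RotatesBy.zero {n : ℕ} (t : Fin n) : RotatesBy 0 t fun _ => 0 :=
  ⟨[], by simp [Circuit.gateCount], fun x θ => by simp [Circuit.matrix]⟩

/-- The state depends on θ/2, so the period is 4π rather than 2π. -/
theorem rotState_add_period {n : ℕ} (t : Fin n) (x : Fin n → Fin 2) (θ : ℝ) (z : ℤ) :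
    rotState t x (θ + z * (4 * Real.pi)) = rotState t x θ := by
  have : (θ + z * (4 * Real.pi)) / 2 = θ / 2 + z * (2 * Real.pi) := by ring
  rw [rotState, rotState, this, Real.cos_add_int_mul_two_pi, Real.sin_add_int_mul_two_pi]

/-- Elementary rotations only have angles in (0, 4π): the angle is reduced modulo 4π, and a residue
0 is realized by the empty circuit. -/
theorem rotatesBy_const {n : ℕ} (t : Fin n) (α : ℝ) : RotatesBy 1 t fun _ => α := by
  have h4 : (0 : ℝ) < 4 * Real.pi := by positivity
  obtain ⟨z, β, hβ, hα⟩ : ∃ (z : ℤ) (β : ℝ), β ∈ Set.Ico 0 (4 * Real.pi) ∧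
      α = β + z * (4 * Real.pi) := by
    refine ⟨toIcoDiv h4 0 α, toIcoMod h4 0 α, by simpa using toIcoMod_mem_Ico h4 0 α, ?_⟩
    rw [← zsmul_eq_mul, toIcoMod_add_toIcoDiv_zsmul]
  rcases hβ.1.eq_or_lt with h0 | h0
  · refine ⟨[], by simp [Circuit.gateCount], fun x θ => ?_⟩
    rw [hα, ← h0, zero_add, rotState_add_period]
    simp [Circuit.matrix]
  · obtain ⟨C, h1, h2⟩ := realizes_gate1 (.Ry β ⟨h0, hβ.2⟩) t
    refine ⟨C, h1, fun x θ => ?_⟩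
    rw [hα, ← add_assoc, rotState_add_period, rotState, Matrix.mulVec_add, Matrix.mulVec_smul,
      Matrix.mulVec_smul, h2, h2, rotState, add_div, Real.cos_add, Real.sin_add]
    simp only [update_self, update_idem, Gate1.matrix]
    funext y
    simp
    ring

/-- A CNOT onto `t` with set control exchanges cosine and sine, that is, it reflects θ to π - θ. A
rotation by α between two reflections is a rotation by -α. -/
theorem RotatesBy.cnot_conj {n c : ℕ} {t a : Fin n} (hat : a ≠ t) {α : ℝ}
    (h : RotatesBy c t fun _ => α) :
    RotatesBy (4 * n + 2 + c) t fun x => (1 - 2 * ((x a).val : ℝ)) * α := by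
  obtain ⟨C, h1, h2⟩ := realizes_cnot hat
  obtain ⟨D, h1', h2'⟩ := h
  have key : ∀ (x : Fin n → Fin 2) (θ : ℝ), C.matrix.mulVec (rotState t x θ) =
      rotState t x (if x a = 0 then θ else Real.pi - θ) := by
    intro x θ
    rw [rotState, Matrix.mulVec_add, Matrix.mulVec_smul, Matrix.mulVec_smul, h2, h2, rotState]
    simp only [flipBy, update_self, update_idem, update_of_ne hat]
    rcases fin2_cases (x a) with h | h
    · simp [h]
    · have e : (Real.pi - θ) / 2 = Real.pi / 2 - θ / 2 := by ring
      simp only [h, Fin.isValue, one_ne_zero, if_false, e, Real.cos_pi_div_two_sub,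
        Real.sin_pi_div_two_sub]
      rw [add_comm]
      rfl
  refine ⟨C ++ (D ++ C), by simp only [Circuit.gateCount_append]; omega, fun x θ => ?_⟩
  rw [Circuit.matrix_append, Circuit.matrix_append, ← Matrix.mulVec_mulVec,
    ← Matrix.mulVec_mulVec, key, h2', key]
  congr 1
  rcases fin2_cases (x a) with h | h <;> simp [h]
  ring

/-- The controlled angle splits as α/2 - (1 - 2a)α/2: a free rotation and one whose sign depends on
the control. -/
theorem rotatesBy_controlled {n : ℕ} {t a : Fin n} (hat : a ≠ t) (α : ℝ) :
    RotatesBy (4 * n + 4) t fun x => ((x a).val : ℝ) * α := by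
  have := (rotatesBy_const t (α / 2)).comp ((rotatesBy_const t (-α / 2)).cnot_conj hat)
  obtain ⟨C, h1, h2⟩ := this
  refine ⟨C, by omega, fun x θ => ?_⟩
  rw [h2]
  congr 1
  ring

theorem rotatesBy_list {n : ℕ} {t : Fin n} (cs : List (Fin n × ℝ)) (h : ∀ p ∈ cs, p.1 ≠ t) :
    RotatesBy (cs.length * (4 * n + 4)) t
      fun x => (cs.map fun p => ((x p.1).val : ℝ) * p.2).sum := by
  induction cs with
  | nil => simpa using RotatesBy.zero t
  | cons p cs ih =>
    have := (rotatesBy_controlled (h p (by simp)) p.2).comp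
      (ih fun q hq => h q (List.mem_cons_of_mem _ hq))
    obtain ⟨C, h1, h2⟩ := this
    refine ⟨C, h1.trans (by rw [List.length_cons]; ring_nf; omega), fun x θ => ?_⟩
    simp [h2]

/-! # Reversible programs -/

/-- Reversible gates on wires named by `ι`. -/
inductive RevGate (ι : Type*) : Type _
  | not (a : ι)
  | cnot (a b : ι)
  | tof (a b c : ι)

variable {ι : Type*}

/-- The action of a reversible gate on bits; a gate with coinciding wires does nothing. -/
def RevGate.run [DecidableEq ι] : RevGate ι → (ι → Fin 2) → ι → Fin 2
  | .not a, x => update x a (x a + 1)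
  | .cnot a b, x => if a = b then x else flipBy a b x
  | .tof a b c, x => if a = b ∨ a = c ∨ b = c then x else flipByAnd a b c x

/-- The action of a sequence of reversible gates, the first one applied first. -/
def run [DecidableEq ι] (p : List (RevGate ι)) (x : ι → Fin 2) : ι → Fin 2 := p.foldl (fun x g => g.run x) x

@[simp] theorem run_nil [DecidableEq ι] (x : ι → Fin 2) : run [] x = x := rfl

@[simp] theorem run_cons [DecidableEq ι] (g : RevGate ι) (p : List (RevGate ι)) (x : ι → Fin 2) :
    run (g :: p) x = run p (g.run x) := rfl

@[simp] theorem run_append [DecidableEq ι] (p q : List (RevGate ι)) (x : ι → Fin 2) :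
    run (p ++ q) x = run q (run p x) := by
  simp [run]

theorem update_comp_embedding [DecidableEq ι] {n : ℕ} (f : ι ↪ Fin n) (y : Fin n → Fin 2) (a : ι) (v : Fin 2) :
    update y (f a) v ∘ f = update (y ∘ f) a v :=
  update_comp_eq_of_injective y f.injective a v

/-- The bound is the cost of the Toffoli gate, the most expensive case. The clause about qubits
outside the range of `f` later keeps the rotated qubit at 0. -/
theorem RevGate.exists_circuit [DecidableEq ι] {n : ℕ} (g : RevGate ι) (f : ι ↪ Fin n) :
    ∃ C : Circuit n, C.gateCount ≤ 12 * n + 15 ∧ ∀ y, ∃ y', C.matrix.mulVec (ket y) = ket y' ∧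
      y' ∘ f = g.run (y ∘ f) ∧ ∀ q, q ∉ Set.range f → y' q = y q := by
  have hof : ∀ {c : ℕ} {φ : (Fin n → Fin 2) → Fin n → Fin 2}, c ≤ 12 * n + 15 →
      Realizes c (fun x => ket (φ x)) → (∀ y, φ y ∘ f = g.run (y ∘ f)) →
      (∀ y q, q ∉ Set.range f → φ y q = y q) →
      ∃ C : Circuit n, C.gateCount ≤ 12 * n + 15 ∧ ∀ y, ∃ y', C.matrix.mulVec (ket y) = ket y' ∧
        y' ∘ f = g.run (y ∘ f) ∧ ∀ q, q ∉ Set.range f → y' q = y q := by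
    rintro c φ hc ⟨C, h1, h2⟩ h3 h4
    exact ⟨C, h1.trans hc, fun y => ⟨φ y, h2 y, h3 y, h4 y⟩⟩
  cases g with
  | not a =>
    refine hof (by omega) (realizes_not (f a)) (fun y => ?_) fun y q hq => ?_
    · simp [RevGate.run, update_comp_embedding]
    · exact update_of_ne (fun h => hq ⟨a, h.symm⟩) _ _
  | cnot a b =>
    by_cases h : a = b
    · exact hof (by omega) (Realizes.id 0) (fun y => by simp [RevGate.run, h]) fun y q hq => rfl
    · refine hof (by omega) (realizes_cnot (f.injective.ne h)) (fun y => ?_) fun y q hq => ?_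
      · simp [RevGate.run, h, flipBy, update_comp_embedding]
      · exact update_of_ne (fun h => hq ⟨b, h.symm⟩) _ _
  | tof a b c =>
    by_cases h : a = b ∨ a = c ∨ b = c
    · exact hof (by omega) (Realizes.id 0) (fun y => by simp [RevGate.run, h]) fun y q hq => rfl
    · have h' := h
      push Not at h'
      refine hof le_rfl (realizes_toffoli (f.injective.ne h'.1) (f.injective.ne h'.2.1)
        (f.injective.ne h'.2.2)) (fun y => ?_) fun y q hq => ?_
      · simp [RevGate.run, h, flipByAnd, update_comp_embedding]
      · exact update_of_ne (fun h => hq ⟨c, h.symm⟩) _ _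

theorem exists_circuit_run [DecidableEq ι] {n : ℕ} (p : List (RevGate ι)) (f : ι ↪ Fin n) :
    ∃ C : Circuit n, C.gateCount ≤ p.length * (12 * n + 15) ∧
      ∀ y, ∃ y', C.matrix.mulVec (ket y) = ket y' ∧
        y' ∘ f = run p (y ∘ f) ∧ ∀ q, q ∉ Set.range f → y' q = y q := by
  induction p with
  | nil => exact ⟨[], by simp [Circuit.gateCount], fun y => ⟨y, by simp [Circuit.matrix]⟩⟩
  | cons g p ih =>
    obtain ⟨C, h1, h2⟩ := g.exists_circuit f
    obtain ⟨D, h1', h2'⟩ := ih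
    refine ⟨C ++ D, ?_, fun y => ?_⟩
    · rw [Circuit.gateCount_append, List.length_cons]
      ring_nf at h1 h1' ⊢
      omega
    · obtain ⟨y', e1, e2, e3⟩ := h2 y
      obtain ⟨y'', e1', e2', e3'⟩ := h2' y'
      refine ⟨y'', ?_, ?_, fun q hq => (e3' q hq).trans (e3 q hq)⟩
      · rw [Circuit.matrix_append, ← Matrix.mulVec_mulVec, e1, e1']
      · rw [e2', e2, run_cons]

/-! # Addition of constants -/

theorem modEq_of_eq {n a b : ℤ} (h : a = b) : a ≡ b [ZMOD n] := h ▸ Int.ModEq.refl a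

/-- The number with the binary digits `x b`, `b ∈ bs`, the least significant one first. -/
def bitVal : List ι → (ι → Fin 2) → ℤ
  | [], _ => 0
  | b :: bs, x => (x b).val + 2 * bitVal bs x

theorem bitVal_congr {bs : List ι} {x y : ι → Fin 2} (h : ∀ q ∈ bs, x q = y q) :
    bitVal bs x = bitVal bs y := by
  induction bs with
  | nil => rfl
  | cons b bs ih =>
    rw [bitVal, bitVal, ih fun q hq => h q (List.mem_cons_of_mem _ hq), h b (by simp)]

theorem bitVal_nonneg (bs : List ι) (x : ι → Fin 2) : 0 ≤ bitVal bs x := by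
  induction bs with
  | nil => simp [bitVal]
  | cons b bs ih => rw [bitVal]; positivity

theorem bitVal_lt (bs : List ι) (x : ι → Fin 2) : bitVal bs x < 2 ^ bs.length := by
  induction bs with
  | nil => simp [bitVal]
  | cons b bs ih => rw [bitVal, List.length_cons, pow_succ]; omega

theorem bitVal_append (bs cs : List ι) (x : ι → Fin 2) :
    bitVal (bs ++ cs) x = bitVal bs x + 2 ^ bs.length * bitVal cs x := by
  induction bs with
  | nil => simp [bitVal]
  | cons b bs ih => rw [List.cons_append, bitVal, ih, bitVal, List.length_cons]; ring

theorem bitVal_eq_zero {bs : List ι} {x : ι → Fin 2} (h : ∀ q ∈ bs, x q = 0) :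
    bitVal bs x = 0 := by
  induction bs with
  | nil => rfl
  | cons b bs ih =>
    rw [bitVal, ih fun q hq => h q (List.mem_cons_of_mem _ hq), h b (by simp)]
    simp

/-- Increment the register `bs` if the bit `c` is set; `as` are clean carry bits. -/
def incProg (c : ι) : List ι → List ι → List (RevGate ι)
  | b :: bs, a :: as => .tof c b a :: (incProg a bs as ++ [.tof c b a, .cnot c b])
  | _, _ => []

theorem length_incProg (c : ι) (bs as : List ι) : (incProg c bs as).length ≤ 3 * bs.length := by
  induction bs generalizing c as with
  | nil => simp [incProg]
  | cons b bs ih =>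
    cases as with
    | nil => simp [incProg]
    | cons a as =>
      have := ih a as
      simp only [incProg, List.length_cons, List.length_append, List.length_nil]
      omega

/-- The carry `a` receives c·b and controls the increment of the higher bits. As neither `c` nor `b`
has changed meanwhile, a second Toffoli gate clears `a`, and only then is `b` flipped. All carries
are thus clean again; the carry out of the last bit is lost, whence the congruence. -/
theorem run_incProg [DecidableEq ι] (c : ι) (bs as : List ι) (x : ι → Fin 2) (hnd : (bs ++ as).Nodup)
    (hc : c ∉ bs ++ as) (hlen : bs.length ≤ as.length) (h0 : ∀ a ∈ as, x a = 0) :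
    (∀ q, q ∉ bs → run (incProg c bs as) x q = x q) ∧
      bitVal bs (run (incProg c bs as) x) ≡ bitVal bs x + (x c).val [ZMOD 2 ^ bs.length] := by
  induction bs generalizing c as x with
  | nil => exact ⟨by simp [incProg], by simpa using Int.modEq_one⟩
  | cons b bs ih =>
    cases as with
    | nil => simp at hlen
    | cons a as =>
      simp only [List.cons_append, List.nodup_cons, List.mem_append, List.mem_cons, not_or,
        List.nodup_append, ne_eq] at hnd hc
      obtain ⟨⟨hb1, hba, hb2⟩, hbs, ⟨ha, has⟩, hdisj⟩ := hnd
      obtain ⟨hcb, hc1, hca, hc2⟩ := hc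
      have habs : a ∉ bs := fun h => hdisj a h a (Or.inl rfl) rfl
      set x1 := flipByAnd c b a x with hx1
      have hx1a : x1 a = x c * x b := by
        simp [hx1, flipByAnd, h0 a (by simp)]
      have hx1q : ∀ q, q ≠ a → x1 q = x q := fun q hq => by simp [hx1, flipByAnd, hq]
      obtain ⟨hf, hv⟩ := ih a as x1
        (List.nodup_append.2 ⟨hbs, has, fun p hp q hq => hdisj p hp q (Or.inr hq)⟩)
        (by simp [habs, ha]) (by simpa using hlen)
        (fun q hq => by rw [hx1q q (fun h => ha (h ▸ hq)), h0 q (List.mem_cons_of_mem _ hq)])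
      set y := run (incProg a bs as) x1 with hy
      have hyc : y c = x c := by rw [hf c hc1, hx1q c hca]
      have hyb : y b = x b := by rw [hf b hb1, hx1q b hba]
      have hya : y a = x c * x b := by rw [hf a habs, hx1a]
      have hrun : run (incProg c (b :: bs) (a :: as)) x =
          update (update y a 0) b (x b + x c) := by
        simp only [incProg, run_cons, run_append, RevGate.run, hcb, hca, hba, or_self, if_false,
          run_nil, ← hx1, ← hy]
        have : flipByAnd c b a y = update y a 0 := by
          rw [flipByAnd, hya, hyb, hyc]
          congr 1
          generalize x c * x b = t
          omega
        rw [this, flipBy, update_of_ne hba, update_of_ne hca, hyb, hyc]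
      rw [hrun]
      refine ⟨fun q hq => ?_, ?_⟩
      · simp only [List.mem_cons, not_or] at hq
        rw [update_of_ne hq.1]
        by_cases hqa : q = a
        · rw [hqa, update_self, h0 a (by simp)]
        · rw [update_of_ne hqa, hf q hq.2, hx1q q hqa]
      · have e1 : bitVal bs (update (update y a 0) b (x b + x c)) = bitVal bs y :=
          bitVal_congr fun q hq => by
            rw [update_of_ne (ne_of_mem_of_not_mem hq hb1),
              update_of_ne (ne_of_mem_of_not_mem hq habs)]
        have e2 : bitVal bs x1 = bitVal bs x :=
          bitVal_congr fun q hq => hx1q q (fun h => habs (h ▸ hq))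
        rw [bitVal, bitVal, e1, update_self, List.length_cons, pow_succ']
        rw [e2, hx1a] at hv
        have hv2 := (hv.mul_left' (c := 2)).add_left (((x b + x c : Fin 2).val : ℕ) : ℤ)
        -- What remains is the half adder identity (b ⊕ c) + 2bc = b + c.
        refine hv2.trans (modEq_of_eq ?_)
        rcases fin2_cases (x b) with h1 | h1 <;> rcases fin2_cases (x c) with h2 | h2 <;>
          simp [h1, h2] <;> ring

/-- Add the constant `V` to the register `bs` if the bit `c` is set. -/
def addProg (c : ι) : List ι → List ι → ℤ → List (RevGate ι)
  | b :: bs, a :: as, V =>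
    addProg c bs as (V / 2) ++ if V % 2 = 1 then incProg c (b :: bs) (a :: as) else []
  | _, _, _ => []

theorem length_addProg (c : ι) (bs as : List ι) (V : ℤ) :
    (addProg c bs as V).length ≤ 3 * bs.length ^ 2 := by
  induction bs generalizing as V with
  | nil => simp [addProg]
  | cons b bs ih =>
    cases as with
    | nil => simp [addProg]
    | cons a as =>
      have h1 := ih as (V / 2)
      have h2 := length_incProg c (b :: bs) (a :: as)
      have h3 : (if V % 2 = 1 then incProg c (b :: bs) (a :: as) else []).length ≤
          3 * (b :: bs).length := by split_ifs <;> simp_all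
      simp only [addProg, List.length_append]
      simp only [List.length_cons] at h3 ⊢
      nlinarith

/-- Since V = 2(V / 2) + V % 2, adding V / 2 to the higher bits and then incrementing if V is odd
adds V. The division is floored and the claim is modulo a power of two, so negative V need no
separate treatment. -/
theorem run_addProg [DecidableEq ι] (c : ι) (bs as : List ι) (V : ℤ) (x : ι → Fin 2) (hnd : (bs ++ as).Nodup)
    (hc : c ∉ bs ++ as) (hlen : bs.length ≤ as.length) (h0 : ∀ a ∈ as, x a = 0) :
    (∀ q, q ∉ bs → run (addProg c bs as V) x q = x q) ∧
      bitVal bs (run (addProg c bs as V) x) ≡ bitVal bs x + (x c).val * V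
        [ZMOD 2 ^ bs.length] := by
  induction bs generalizing as V with
  | nil => exact ⟨by simp [addProg], by simpa using Int.modEq_one⟩
  | cons b bs ih =>
    cases as with
    | nil => simp at hlen
    | cons a as =>
      have hnd' := hnd
      have hc' := hc
      simp only [List.cons_append, List.nodup_cons, List.mem_append, List.mem_cons, not_or,
        List.nodup_append, ne_eq] at hnd' hc'
      obtain ⟨⟨hb1, hba, hb2⟩, hbs, ⟨ha, has⟩, hdisj⟩ := hnd'
      obtain ⟨hf, hv⟩ := ih as (V / 2)
        (List.nodup_append.2 ⟨hbs, has, fun p hp q hq => hdisj p hp q (Or.inr hq)⟩)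
        (by simp [hc'.2.1, hc'.2.2.2]) (by simpa using hlen)
        (fun q hq => h0 q (List.mem_cons_of_mem _ hq))
      set y := run (addProg c bs as (V / 2)) x with hy
      have hval : bitVal (b :: bs) y ≡ bitVal (b :: bs) x + (x c).val * (2 * (V / 2))
          [ZMOD 2 ^ (b :: bs).length] := by
        rw [bitVal, bitVal, hf b hb1, List.length_cons, pow_succ']
        refine ((hv.mul_left' (c := 2)).add_left (((x b).val : ℕ) : ℤ)).trans
          (modEq_of_eq ?_)
        ring
      rw [addProg, run_append, ← hy]
      split_ifs with hV
      · obtain ⟨hf', hv'⟩ := run_incProg c (b :: bs) (a :: as) y hnd hc hlen (fun q hq => by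
          rw [hf q (fun h => ?_), h0 q hq]
          rcases List.mem_cons.1 hq with rfl | hq
          · exact hdisj _ h _ (Or.inl rfl) rfl
          · exact hdisj _ h _ (Or.inr hq) rfl)
        refine ⟨fun q hq => ?_, ?_⟩
        · rw [hf' q hq, hf q fun h => hq (List.mem_cons_of_mem _ h)]
        · rw [hf c hc'.2.1] at hv'
          refine hv'.trans ((hval.add_right _).trans (modEq_of_eq ?_))
          have : V = 2 * (V / 2) + 1 := by omega
          linear_combination (-((x c).val : ℤ)) * this
      · refine ⟨fun q hq => hf q fun h => hq (List.mem_cons_of_mem _ h), ?_⟩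
        have : 2 * (V / 2) = V := by omega
        rwa [this] at hval

/-- The linear form with coefficients `cs`. -/
def linSum (cs : List (ι × ℤ)) (x : ι → Fin 2) : ℤ := (cs.map fun p => ((x p.1).val : ℤ) * p.2).sum

theorem linSum_congr {cs : List (ι × ℤ)} {x y : ι → Fin 2} (h : ∀ p ∈ cs, x p.1 = y p.1) :
    linSum cs x = linSum cs y := by
  unfold linSum
  congr 1
  exact List.map_congr_left fun p hp => by rw [h p hp]

/-- Add the linear form with coefficients `cs` to the register `bs`. -/
def linProg (cs : List (ι × ℤ)) (bs as : List ι) : List (RevGate ι) :=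
  cs.flatMap fun p => addProg p.1 bs as p.2

theorem length_linProg (cs : List (ι × ℤ)) (bs as : List ι) :
    (linProg cs bs as).length ≤ cs.length * (3 * bs.length ^ 2) := by
  induction cs with
  | nil => simp [linProg]
  | cons p cs ih =>
    have := length_addProg p.1 bs as p.2
    simp only [linProg, List.flatMap_cons, List.length_append, List.length_cons] at ih ⊢
    rw [Nat.succ_mul]
    omega

theorem run_linProg [DecidableEq ι] (cs : List (ι × ℤ)) (bs as : List ι) (x : ι → Fin 2) (hnd : (bs ++ as).Nodup)
    (hc : ∀ p ∈ cs, p.1 ∉ bs ++ as) (hlen : bs.length ≤ as.length) (h0 : ∀ a ∈ as, x a = 0) :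
    (∀ q, q ∉ bs → run (linProg cs bs as) x q = x q) ∧
      bitVal bs (run (linProg cs bs as) x) ≡ bitVal bs x + linSum cs x [ZMOD 2 ^ bs.length] := by
  have hdisj := (List.nodup_append.1 hnd).2.2
  induction cs generalizing x with
  | nil => simp [linProg, linSum]
  | cons p cs ih =>
    obtain ⟨hf, hv⟩ := run_addProg p.1 bs as p.2 x hnd (hc p (by simp)) hlen h0
    obtain ⟨hf', hv'⟩ := ih (run (addProg p.1 bs as p.2) x)
      (fun q hq => hc q (List.mem_cons_of_mem _ hq))
      (fun q hq => by rw [hf q fun h => hdisj _ h _ hq rfl, h0 q hq])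
    have hrun : run (linProg (p :: cs) bs as) x =
        run (linProg cs bs as) (run (addProg p.1 bs as p.2) x) := by
      simp [linProg]
    rw [hrun]
    refine ⟨fun q hq => (hf' q hq).trans (hf q hq), ?_⟩
    have e : linSum cs (run (addProg p.1 bs as p.2) x) = linSum cs x :=
      linSum_congr fun q hq => hf _ fun h => hc q (List.mem_cons_of_mem _ hq)
        (List.mem_append_left _ h)
    rw [e] at hv'
    refine hv'.trans ((hv.add_right _).trans (modEq_of_eq ?_))
    simp only [linSum, List.map_cons, List.sum_cons]
    ring

/-- Add the linear form with coefficients `cs` to the register `bs` if the bit `s` is set;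
`f` is a clean bit. -/
def ctrlLinProg (s f : ι) (cs : List (ι × ℤ)) (bs as : List ι) : List (RevGate ι) :=
  cs.flatMap fun p => .tof s p.1 f :: (addProg f bs as p.2 ++ [.tof s p.1 f])

theorem length_ctrlLinProg (s f : ι) (cs : List (ι × ℤ)) (bs as : List ι) :
    (ctrlLinProg s f cs bs as).length ≤ cs.length * (3 * bs.length ^ 2 + 2) := by
  induction cs with
  | nil => simp [ctrlLinProg]
  | cons p cs ih =>
    have := length_addProg f bs as p.2
    simp only [ctrlLinProg, List.flatMap_cons, List.length_append, List.length_cons,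
      List.length_nil] at ih ⊢
    rw [Nat.succ_mul]
    omega

/-- The product of `s` and the term's bit is put into `f`, which then controls the addition. Both
factors lie outside the target register, so the same Toffoli gate resets `f` for the next term. -/
theorem run_ctrlLinProg [DecidableEq ι] (s f : ι) (cs : List (ι × ℤ)) (bs as : List ι) (x : ι → Fin 2)
    (hnd : (f :: s :: (bs ++ as)).Nodup) (hc : ∀ p ∈ cs, p.1 ∉ f :: s :: (bs ++ as))
    (hlen : bs.length ≤ as.length) (h0 : ∀ a ∈ as, x a = 0) (hf0 : x f = 0) :
    (∀ q, q ∉ bs → run (ctrlLinProg s f cs bs as) x q = x q) ∧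
      bitVal bs (run (ctrlLinProg s f cs bs as) x) ≡ bitVal bs x + (x s).val * linSum cs x
        [ZMOD 2 ^ bs.length] := by
  simp only [List.nodup_cons, List.mem_cons, not_or, List.mem_append] at hnd
  obtain ⟨⟨hfs, hfb, hfa⟩, ⟨hsb, hsa⟩, hnd⟩ := hnd
  have hdisj := (List.nodup_append.1 hnd).2.2
  induction cs generalizing x with
  | nil => simp [ctrlLinProg, linSum]
  | cons p cs ih =>
    have hp := hc p (by simp)
    simp only [List.mem_cons, not_or, List.mem_append] at hp
    obtain ⟨hpf, hps, hpb, hpa⟩ := hp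
    set x1 := flipByAnd s p.1 f x with hx1
    have hx1f : x1 f = x s * x p.1 := by simp [hx1, flipByAnd, hf0]
    have hx1q : ∀ q, q ≠ f → x1 q = x q := fun q hq => by simp [hx1, flipByAnd, hq]
    obtain ⟨hf, hv⟩ := run_addProg f bs as p.2 x1 hnd (by simp [hfb, hfa]) hlen
      (fun q hq => by rw [hx1q q fun h => hfa (h ▸ hq), h0 q hq])
    set y := run (addProg f bs as p.2) x1 with hy
    have hz : flipByAnd s p.1 f y = update y f 0 := by
      rw [flipByAnd, hf f hfb, hf s hsb, hf p.1 hpb, hx1f, hx1q s (Ne.symm hfs), hx1q p.1 hpf]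
      congr 1
      generalize x s * x p.1 = t
      omega
    have hzq : ∀ q, q ∉ bs → update y f 0 q = x q := fun q hq => by
      by_cases hqf : q = f
      · rw [hqf, update_self, hf0]
      · rw [update_of_ne hqf, hf q hq, hx1q q hqf]
    obtain ⟨hf', hv'⟩ := ih (update y f 0) (fun q hq => hc q (List.mem_cons_of_mem _ hq))
      (fun q hq => by rw [hzq q fun h => hdisj _ h _ hq rfl, h0 q hq]) (by simp)
    have hrun : run (ctrlLinProg s f (p :: cs) bs as) x =
        run (ctrlLinProg s f cs bs as) (update y f 0) := by
      have e : run (ctrlLinProg s f (p :: cs) bs as) x = run (ctrlLinProg s f cs bs as)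
          ((RevGate.tof s p.1 f).run
            (run (addProg f bs as p.2) ((RevGate.tof s p.1 f).run x))) := by
        simp [ctrlLinProg]
      rw [e]
      simp only [RevGate.run, Ne.symm hps, Ne.symm hfs, hpf, or_self, if_false]
      rw [← hx1, ← hy, hz]
    rw [hrun]
    refine ⟨fun q hq => (hf' q hq).trans (hzq q hq), ?_⟩
    have e : linSum cs (update y f 0) = linSum cs x :=
      linSum_congr fun q hq => hzq _ fun h => hc q (List.mem_cons_of_mem _ hq) (by simp [h])
    have e2 : bitVal bs (update y f 0) = bitVal bs y :=
      bitVal_congr fun q hq => update_of_ne (ne_of_mem_of_not_mem hq hfb) _ _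
    have e3 : bitVal bs x1 = bitVal bs x :=
      bitVal_congr fun q hq => hx1q q (fun h => hfb (h ▸ hq))
    rw [e, e2, hzq s hsb] at hv'
    rw [e3, hx1f] at hv
    refine hv'.trans ((hv.add_right _).trans (modEq_of_eq ?_))
    simp only [linSum, List.map_cons, List.sum_cons]
    rcases fin2_cases (x s) with h1 | h1 <;> rcases fin2_cases (x p.1) with h2 | h2 <;>
      simp [h1, h2]
    ring

/-! # Signed registers and the running maximum -/

/-- The linear form `p * bitVal bs`. -/
def bitTerms : ℤ → List ι → List (ι × ℤ)
  | _, [] => []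
  | p, b :: bs => (b, p) :: bitTerms (2 * p) bs

theorem linSum_bitTerms (p : ℤ) (bs : List ι) (x : ι → Fin 2) :
    linSum (bitTerms p bs) x = p * bitVal bs x := by
  induction bs generalizing p with
  | nil => simp [bitTerms, linSum, bitVal]
  | cons b bs ih =>
    have := ih (2 * p)
    simp only [linSum, bitTerms, List.map_cons, List.sum_cons, bitVal] at this ⊢
    rw [this]
    ring

theorem fst_mem_of_mem_bitTerms {p : ℤ} {bs : List ι} {q : ι × ℤ} (h : q ∈ bitTerms p bs) :
    q.1 ∈ bs := by
  induction bs generalizing p with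
  | nil => simp [bitTerms] at h
  | cons b bs ih =>
    rcases List.mem_cons.1 h with rfl | h
    · simp
    · exact List.mem_cons_of_mem _ (ih h)

theorem length_bitTerms (p : ℤ) (bs : List ι) : (bitTerms p bs).length = bs.length := by
  induction bs generalizing p with
  | nil => rfl
  | cons b bs ih => simp [bitTerms, ih]

/-- The two's complement value of the register with the bits `bs`, the least significant one
first, and the sign bit `s`. -/
def signedVal (bs : List ι) (s : ι) (x : ι → Fin 2) : ℤ :=
  bitVal bs x - 2 ^ bs.length * (x s).val

/-- The linear form `p * signedVal bs s`. -/
def signedTerms (p : ℤ) (bs : List ι) (s : ι) : List (ι × ℤ) :=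
  bitTerms p bs ++ [(s, -(p * 2 ^ bs.length))]

theorem linSum_signedTerms (p : ℤ) (bs : List ι) (s : ι) (x : ι → Fin 2) :
    linSum (signedTerms p bs s) x = p * signedVal bs s x := by
  have := linSum_bitTerms p bs x
  simp only [linSum] at this
  simp only [linSum, signedTerms, List.map_append, List.sum_append, this, signedVal]
  simp
  ring

theorem fst_mem_of_mem_signedTerms {p : ℤ} {bs : List ι} {s : ι} {q : ι × ℤ}
    (h : q ∈ signedTerms p bs s) : q.1 ∈ bs ∨ q.1 = s := by
  rcases List.mem_append.1 h with h | h
  · exact Or.inl (fst_mem_of_mem_bitTerms h)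
  · simp only [List.mem_singleton] at h
    exact Or.inr (by rw [h])

theorem length_signedTerms (p : ℤ) (bs : List ι) (s : ι) :
    (signedTerms p bs s).length = bs.length + 1 := by
  simp [signedTerms, length_bitTerms]

theorem signedVal_congr {bs : List ι} {s : ι} {x y : ι → Fin 2} (h : ∀ q ∈ bs, x q = y q)
    (hs : x s = y s) : signedVal bs s x = signedVal bs s y := by
  rw [signedVal, signedVal, bitVal_congr h, hs]

/-- Counting the sign bit with weight 2^len or -2^len makes a difference of a multiple of 2^(len+1),
so the unsigned adders also serve signed registers. -/
theorem signedVal_modEq (bs : List ι) (s : ι) (x : ι → Fin 2) :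
    signedVal bs s x ≡ bitVal (bs ++ [s]) x [ZMOD 2 ^ (bs ++ [s]).length] := by
  rw [bitVal_append, signedVal, Int.modEq_iff_dvd]
  refine ⟨(x s).val, ?_⟩
  simp only [bitVal, List.length_append, List.length_singleton]
  ring

theorem signedVal_mem (bs : List ι) (s : ι) (x : ι → Fin 2) :
    -2 ^ bs.length ≤ signedVal bs s x ∧ signedVal bs s x < 2 ^ bs.length := by
  have h1 := bitVal_nonneg bs x
  have h2 := bitVal_lt bs x
  have h3 : (0 : ℤ) < 2 ^ bs.length := by positivity
  rw [signedVal]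
  rcases fin2_cases (x s) with h | h <;> simp [h] <;> constructor <;> linarith

/-- Both numbers lie in a half-open interval whose length is the modulus, so congruence forces
equality. This turns modular results into exact ones once the range is known. -/
theorem signedVal_eq_of_modEq {bs : List ι} {s : ι} {x : ι → Fin 2} {v : ℤ}
    (h : bitVal (bs ++ [s]) x ≡ v [ZMOD 2 ^ (bs ++ [s]).length]) (h1 : -2 ^ bs.length ≤ v)
    (h2 : v < 2 ^ bs.length) : signedVal bs s x = v := by
  obtain ⟨h3, h4⟩ := signedVal_mem bs s x
  obtain ⟨k, hk⟩ := ((signedVal_modEq bs s x).trans h).dvd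
  have hp : (0 : ℤ) < 2 ^ bs.length := by positivity
  rw [List.length_append, List.length_singleton, pow_succ] at hk
  have : k = 0 := by
    by_contra hne
    rcases lt_or_gt_of_ne hne with hk0 | hk0 <;> nlinarith
  rw [this] at hk
  linarith

/-- Replace the value of the register `M` (sign bit `sM`) by its maximum with the linear form with
coefficients `cs`, using the clean register `D` (sign bit `sD`) and the clean bits `f` and `as`. -/
def maxProg (cs : List (ι × ℤ)) (M : List ι) (sM : ι) (D : List ι) (sD f : ι) (as : List ι) :
    List (RevGate ι) :=
  linProg cs (D ++ [sD]) as ++ (linProg (signedTerms (-1) M sM) (D ++ [sD]) as ++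
    (.not sD :: ctrlLinProg sD f (bitTerms 1 D) (M ++ [sM]) as))

theorem length_maxProg (cs : List (ι × ℤ)) (M : List ι) (sM : ι) (D : List ι) (sD f : ι)
    (as : List ι) (h : M.length = D.length) :
    (maxProg cs M sM D sD f as).length ≤
      (cs.length + 2 * D.length + 1) * (3 * (D.length + 1) ^ 2) + 2 * D.length + 1 := by
  have h1 := length_linProg cs (D ++ [sD]) as
  have h2 := length_linProg (signedTerms (-1) M sM) (D ++ [sD]) as
  have h3 := length_ctrlLinProg sD f (bitTerms 1 D) (M ++ [sM]) as
  simp only [maxProg, List.length_append, List.length_cons, List.length_nil,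
    length_signedTerms, length_bitTerms, h] at *
  nlinarith

/-- The register `D` receives v - M, where v is the linear form. Its negated sign bit tells whether
v ≥ M, and in that case adding `D` to `M` gives v. The values lie in [-2^u, 2^u), but the registers
have u + 1 low bits and a sign bit, so that the difference fits too. -/
theorem run_maxProg [DecidableEq ι] (cs : List (ι × ℤ)) (M : List ι) (sM : ι) (D : List ι) (sD f : ι)
    (as : List ι) (x : ι → Fin 2) (u : ℕ) (hM : M.length = u + 1) (hD : D.length = u + 1)
    (has : as.length = u + 2) (hnd : (f :: ((M ++ [sM]) ++ ((D ++ [sD]) ++ as))).Nodup)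
    (hc : ∀ p ∈ cs, p.1 ∉ (M ++ [sM]) ++ ((D ++ [sD]) ++ as))
    (h0 : ∀ q ∈ f :: ((D ++ [sD]) ++ as), x q = 0)
    (hv1 : -2 ^ u ≤ linSum cs x) (hv2 : linSum cs x < 2 ^ u)
    (hM1 : -2 ^ u ≤ signedVal M sM x) (hM2 : signedVal M sM x < 2 ^ u) :
    (∀ q, q ∉ (M ++ [sM]) ++ (D ++ [sD]) → run (maxProg cs M sM D sD f as) x q = x q) ∧
      signedVal M sM (run (maxProg cs M sM D sD f as) x) =
        max (signedVal M sM x) (linSum cs x) := by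
  have hMs : ∀ q, q ∈ M ++ [sM] ↔ q ∈ M ∨ q = sM := by simp
  have hDs : ∀ q, q ∈ D ++ [sD] ↔ q ∈ D ∨ q = sD := by simp
  have hlM : (M ++ [sM]).length = u + 2 := by simp [hM]
  have hlD : (D ++ [sD]).length = u + 2 := by simp [hD]
  have hnd' := hnd
  rw [List.nodup_cons, List.nodup_append (l₁ := M ++ [sM]),
    List.nodup_append (l₁ := D ++ [sD])] at hnd'
  obtain ⟨hf, hMnd, ⟨hDnd, hand, hDa⟩, hMDa⟩ := hnd'
  have hDand : ((D ++ [sD]) ++ as).Nodup := List.nodup_append.2 ⟨hDnd, hand, hDa⟩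
  have hMD : ∀ q ∈ M ++ [sM], q ∉ D ++ [sD] := fun q h1 h2 =>
    hMDa q h1 q (List.mem_append_left _ h2) rfl
  have hMa : ∀ q ∈ M ++ [sM], q ∉ as := fun q h1 h2 =>
    hMDa q h1 q (List.mem_append_right _ h2) rfl
  have haD : ∀ q ∈ as, q ∉ D ++ [sD] := fun q h1 h2 => hDa q h2 q h1 rfl
  have hfM : f ∉ M ++ [sM] := fun h => hf (List.mem_append_left _ h)
  have hfD : f ∉ D ++ [sD] := fun h =>
    hf (List.mem_append_right _ (List.mem_append_left _ h))
  have hfa : f ∉ as := fun h => hf (List.mem_append_right _ (List.mem_append_right _ h))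
  have hsD : sD ∈ D ++ [sD] := by simp
  have hsDD : sD ∉ D := fun h => (List.nodup_append.1 hDnd).2.2 _ h sD (by simp) rfl
  have hp : (0 : ℤ) < 2 ^ u := by positivity
  -- the difference
  obtain ⟨hf1, hval1⟩ := run_linProg cs (D ++ [sD]) as x hDand
    (fun p hp h => hc p hp (List.mem_append_right _ h)) (by omega)
    (fun q hq => h0 q (List.mem_cons_of_mem _ (List.mem_append_right _ hq)))
  set y := run (linProg cs (D ++ [sD]) as) x with hy
  obtain ⟨hf2, hval2⟩ := run_linProg (signedTerms (-1) M sM) (D ++ [sD]) as y hDand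
    (fun p hp h => by
      have hpM := (hMs _).2 (fst_mem_of_mem_signedTerms hp)
      rcases List.mem_append.1 h with h | h
      · exact hMD _ hpM h
      · exact hMa _ hpM h) (by omega)
    (fun q hq => by
      rw [hf1 q (haD q hq), h0 q (List.mem_cons_of_mem _ (List.mem_append_right _ hq))])
  set z := run (linProg (signedTerms (-1) M sM) (D ++ [sD]) as) y with hz
  have hzq : ∀ q, q ∉ D ++ [sD] → z q = x q := fun q hq => (hf2 q hq).trans (hf1 q hq)
  have hyM : signedVal M sM y = signedVal M sM x :=
    signedVal_congr (fun q hq => hf1 q (hMD q ((hMs q).2 (Or.inl hq))))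
      (hf1 sM (hMD sM ((hMs sM).2 (Or.inr rfl))))
  -- A difference of two numbers from [-2^u, 2^u) lies strictly between -2^(u+1) and 2^(u+1).
  have hzD : signedVal D sD z = linSum cs x - signedVal M sM x := by
    apply signedVal_eq_of_modEq
    · refine hval2.trans ((hval1.add_right _).trans (modEq_of_eq ?_))
      rw [linSum_signedTerms, hyM, bitVal_eq_zero fun q hq => h0 q
        (List.mem_cons_of_mem _ (List.mem_append_left _ hq))]
      ring
    · rw [hD, pow_succ]; linarith
    · rw [hD, pow_succ]; linarith
  -- the conditional addition
  set z' := update z sD (z sD + 1) with hz'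
  have hz'q : ∀ q, q ≠ sD → z' q = z q := fun q hq => update_of_ne hq _ _
  have hz'0 : ∀ q, q ∉ D ++ [sD] → z' q = x q := fun q hq => by
    rw [hz'q q (fun h => hq (h ▸ hsD)), hzq q hq]
  obtain ⟨hf3, hval3⟩ := run_ctrlLinProg sD f (bitTerms 1 D) (M ++ [sM]) as z'
    (by
      simp only [List.nodup_cons, List.mem_cons, not_or]
      refine ⟨⟨fun h => hfD (h ▸ hsD), ?_⟩, ?_, List.nodup_append.2 ⟨hMnd, hand, ?_⟩⟩
      · simp only [List.mem_append (t := as), not_or]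
        exact ⟨hfM, hfa⟩
      · simp only [List.mem_append (t := as), not_or]
        exact ⟨fun h => hMD _ h hsD, fun h => haD _ h hsD⟩
      · rintro p hp q hq rfl
        exact hMa p hp hq)
    (fun p hp => by
      have hpD := fst_mem_of_mem_bitTerms hp
      have hpDs := (hDs _).2 (Or.inl hpD)
      simp only [List.mem_cons, List.mem_append (t := as), not_or]
      exact ⟨fun h => hfD (h ▸ hpDs), fun h => hsDD (h ▸ hpD), fun h => hMD _ h hpDs,
        fun h => haD _ h hpDs⟩)
    (by omega)
    (fun q hq => by
      rw [hz'0 q (haD q hq), h0 q (List.mem_cons_of_mem _ (List.mem_append_right _ hq))])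
    (by rw [hz'0 f hfD, h0 f (by simp)])
  have hrun : run (maxProg cs M sM D sD f as) x =
      run (ctrlLinProg sD f (bitTerms 1 D) (M ++ [sM]) as) z' := by
    simp only [maxProg, run_append, run_cons, ← hy, ← hz]
    rfl
  rw [hrun]
  refine ⟨fun q hq => ?_, ?_⟩
  · rw [List.mem_append, not_or] at hq
    rw [hf3 q hq.1, hz'0 q hq.2]
  · apply signedVal_eq_of_modEq
    · refine hval3.trans ?_
      have e1 : signedVal M sM z' = signedVal M sM x :=
        signedVal_congr (fun q hq => hz'0 q (hMD q ((hMs q).2 (Or.inl hq))))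
          (hz'0 sM (hMD sM ((hMs sM).2 (Or.inr rfl))))
      have e2 : bitVal D z' = bitVal D z :=
        bitVal_congr fun q hq => hz'q q fun h => hsDD (h ▸ hq)
      have e3 : z' sD = z sD + 1 := update_self _ _ _
      have h1 := bitVal_nonneg D z
      have h2 := bitVal_lt D z
      refine ((signedVal_modEq M sM z').symm.add_right _).trans (modEq_of_eq ?_)
      rw [e1, linSum_bitTerms, e2, e3]
      rw [signedVal] at hzD
      -- If the sign bit was 0, the low bits of `D` are the whole difference; if it was 1, nothing
      -- is added and the difference is negative.
      rcases fin2_cases (z sD) with h | h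
      · simp only [h] at hzD ⊢
        simp at hzD ⊢
        rw [max_eq_right (by linarith)]
        linarith
      · simp only [h] at hzD ⊢
        simp at hzD ⊢
        linarith
    · rw [hM, pow_succ]
      have := le_max_left (signedVal M sM x) (linSum cs x)
      linarith
    · rw [hM, pow_succ]
      have : max (signedVal M sM x) (linSum cs x) < 2 ^ u := max_lt hM2 hv2
      linarith

/-! # Two's complement arithmetic has no overflow -/

/-- The weight of position `t`, scaled by `2 ^ m`. -/
def intWeight (n m t : ℕ) : ℤ := if t = 0 then -2 ^ (n + m - 1) else 2 ^ (n + m - 1 - t)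

theorem weight_mul_two_pow {n m t : ℕ} (ht : t < n + m) :
    weight n t * 2 ^ m = intWeight n m t := by
  unfold weight intWeight
  split_ifs with h
  · push_cast
    rw [neg_mul, ← zpow_natCast (2 : ℚ) m, ← zpow_add₀ (by norm_num), ← zpow_natCast]
    congr 2
    omega
  · push_cast
    rw [← zpow_natCast (2 : ℚ) m, ← zpow_add₀ (by norm_num), ← zpow_natCast]
    congr 1
    omega

/-- The decoder, scaled by `2 ^ m`. -/
def intDecode {n m : ℕ} (x : BitStr n m) : ℤ :=
  ∑ t : Fin (n + m), ((x t).val : ℤ) * intWeight n m t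

theorem decode_mul_two_pow {n m : ℕ} (x : BitStr n m) : decode x * 2 ^ m = intDecode x := by
  rw [decode, intDecode, Finset.sum_mul]
  push_cast
  refine Finset.sum_congr rfl fun t _ => ?_
  rw [mul_assoc, weight_mul_two_pow t.isLt]

theorem sum_two_pow_sub (w : ℕ) : ∑ t ∈ Finset.range w, (2 : ℤ) ^ (w - 1 - t) = 2 ^ w - 1 := by
  rw [Finset.sum_range_reflect (fun t => (2 : ℤ) ^ t) w]
  induction w with
  | zero => simp
  | succ w ih => rw [Finset.sum_range_succ, ih]; ring

theorem intDecode_mem {n m : ℕ} (hn : 1 ≤ n) (x : BitStr n m) :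
    -2 ^ (n + m - 1) ≤ intDecode x ∧ intDecode x < 2 ^ (n + m - 1) := by
  obtain ⟨w, hw⟩ : ∃ w, n + m = w + 1 := ⟨n + m - 1, by omega⟩
  have key : ∀ z : Fin (w + 1) → Fin 2,
      -2 ^ w ≤ ∑ t : Fin (w + 1), ((z t).val : ℤ) * intWeight n m t ∧
        ∑ t : Fin (w + 1), ((z t).val : ℤ) * intWeight n m t < 2 ^ w := by
    intro z
    have h0 : intWeight n m ((0 : Fin (w + 1)) : ℕ) = -2 ^ w := by simp [intWeight, hw]
    have hs : ∀ t : Fin w, intWeight n m (t.succ : ℕ) = 2 ^ (w - 1 - t.val) := fun t => by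
      simp only [intWeight, hw, Fin.val_succ, Nat.succ_ne_zero, if_false]
      congr 1
      omega
    rw [Fin.sum_univ_succ, h0]
    simp only [hs]
    have h1 : 0 ≤ ∑ t : Fin w, ((z t.succ).val : ℤ) * 2 ^ (w - 1 - t.val) :=
      Finset.sum_nonneg fun t _ => by positivity
    have h2 : ∑ t : Fin w, ((z t.succ).val : ℤ) * 2 ^ (w - 1 - t.val) ≤ 2 ^ w - 1 := by
      rw [← sum_two_pow_sub, ← Fin.sum_univ_eq_sum_range (fun t => (2 : ℤ) ^ (w - 1 - t))]
      refine Finset.sum_le_sum fun t _ => mul_le_of_le_one_left (by positivity) ?_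
      have := (z t.succ).isLt
      omega
    have h3 : (0 : ℤ) < 2 ^ w := by positivity
    rcases fin2_cases (z 0) with h | h <;> simp only [h] <;> constructor <;> simp <;> linarith
  have e : n + m - 1 = w := by omega
  rw [e]
  have := key (x ∘ Fin.cast hw.symm)
  convert this using 2 <;>
  · rw [intDecode]
    exact Fintype.sum_equiv (finCongr hw) _ _ fun t => rfl

theorem encodeValue_eq_sum (n : ℕ) (y : ℚ) (t : ℕ) : encodeValue n y t =
    ∑ r ∈ Finset.range t,
      if encodeTest n y r (encodeValue n y r) then weight n r else 0 := by
  induction t with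
  | zero => simp [encodeValue]
  | succ t ih => rw [Finset.sum_range_succ, ← ih, encodeValue]

theorem decode_encode_eq_encodeValue (n m : ℕ) (y : ℚ) :
    decode (encode n m y) = encodeValue n y (n + m) := by
  rw [encodeValue_eq_sum, decode, ← Fin.sum_univ_eq_sum_range
    (fun r => if encodeTest n y r (encodeValue n y r) then weight n r else 0)]
  refine Finset.sum_congr rfl fun t _ => ?_
  rw [encode]
  split_ifs <;> simp

/-- Invariant of the greedy encoder: the scaled remainder is nonnegative and below the absolute
weight of the bit just treated. Each further bit halves the window. -/
theorem encodeValue_mem {n m : ℕ} {y : ℚ} {z : ℤ} (hy : y * 2 ^ m = z)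
    (h1 : -2 ^ (n + m - 1) ≤ z) (h2 : z < 2 ^ (n + m - 1)) (t : ℕ) (ht : t + 1 ≤ n + m) :
    ∃ v : ℤ, encodeValue n y (t + 1) * 2 ^ m = v ∧ v ≤ z ∧ z < v + 2 ^ (n + m - 1 - t) := by
  have hm : (0 : ℚ) < 2 ^ m := by positivity
  induction t with
  | zero =>
    have hneg : y < 0 ↔ z < 0 := by
      rw [← Int.cast_lt (R := ℚ), ← hy, Int.cast_zero]
      constructor <;> intro h <;> nlinarith
    rw [encodeValue, encodeValue, encodeTest, if_pos rfl, zero_add]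
    by_cases h : z < 0
    · refine ⟨-2 ^ (n + m - 1), ?_, h1, by simpa using h⟩
      have := weight_mul_two_pow (n := n) (m := m) (t := 0) (by omega)
      simp only [hneg.2 h, decide_true, if_true]
      rw [this]
      simp [intWeight]
    · refine ⟨0, ?_, by omega, by simpa using h2⟩
      simp [hneg, h]
  | succ t ih =>
    obtain ⟨v, hv, hv1, hv2⟩ := ih (by omega)
    have hw := weight_mul_two_pow (n := n) (m := m) (t := t + 1) (by omega)
    have hw' : intWeight n m (t + 1) = 2 ^ (n + m - 1 - (t + 1)) := by simp [intWeight]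
    rw [hw'] at hw
    have hp : (2 : ℤ) ^ (n + m - 1 - t) = 2 * 2 ^ (n + m - 1 - (t + 1)) := by
      rw [← pow_succ']
      congr 1
      omega
    have htest : encodeValue n y (t + 1) + weight n (t + 1) ≤ y ↔
        v + 2 ^ (n + m - 1 - (t + 1)) ≤ z := by
      rw [← Int.cast_le (R := ℚ), ← hy, Int.cast_add, ← hv, ← hw, ← add_mul]
      exact (mul_le_mul_iff_left₀ hm).symm
    rw [encodeValue, encodeTest, if_neg (Nat.succ_ne_zero t)]
    by_cases h : v + 2 ^ (n + m - 1 - (t + 1)) ≤ z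
    · refine ⟨v + 2 ^ (n + m - 1 - (t + 1)), ?_, h, by linarith⟩
      simp only [htest.2 h, decide_true, if_true]
      rw [add_mul, hv, hw, Int.cast_add]
    · refine ⟨v, ?_, hv1, by linarith⟩
      simp only [htest, h, decide_false, Bool.false_eq_true, if_false, add_zero]
      exact hv

theorem decode_encode {n m : ℕ} (hn : 1 ≤ n) {y : ℚ} {z : ℤ} (hy : y * 2 ^ m = z)
    (h1 : -2 ^ (n + m - 1) ≤ z) (h2 : z < 2 ^ (n + m - 1)) : decode (encode n m y) = y := by
  obtain ⟨v, hv, hv1, hv2⟩ := encodeValue_mem hy h1 h2 (n + m - 1) (by omega)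
  rw [show n + m - 1 + 1 = n + m by omega, ← decode_encode_eq_encodeValue] at hv
  -- After the last bit the window has length 1.
  have : v = z := by
    simp at hv2
    omega
  rw [this, ← hy] at hv
  exact mul_right_cancel₀ (by positivity) hv

theorem intDecode_encode {n m : ℕ} (hn : 1 ≤ n) {y : ℚ} {z : ℤ} (hy : y * 2 ^ m = z)
    (h1 : -2 ^ (n + m - 1) ≤ z) (h2 : z < 2 ^ (n + m - 1)) : intDecode (encode n m y) = z := by
  have h := decode_mul_two_pow (encode n m y)
  rw [decode_encode hn hy h1 h2, hy] at h
  exact_mod_cast h.symm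

/-- The scaled product is at most 2^(n₁+m₁-1) · 2^(n₂+m₂-1) in absolute value, half of the bound
available, so even the product of the two least values fits. -/
theorem intDecode_boxdot {n₁ m₁ n₂ m₂ n m : ℕ} (x : BitStr n₁ m₁) (y : BitStr n₂ m₂)
    (hn : n = n₁ + n₂) (hm : m = m₁ + m₂) (h1 : 1 ≤ n₁) (h2 : 1 ≤ n₂) :
    intDecode (boxdot x y hn hm) = intDecode x * intDecode y := by
  subst hn hm
  refine intDecode_encode (by omega) ?_ ?_ ?_
  · push_cast
    rw [← decode_mul_two_pow, ← decode_mul_two_pow]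
    ring
  all_goals
    obtain ⟨a1, a2⟩ := intDecode_mem h1 x
    obtain ⟨b1, b2⟩ := intDecode_mem h2 y
    have hp : (2 : ℤ) ^ (n₁ + n₂ + (m₁ + m₂) - 1) =
        2 * (2 ^ (n₁ + m₁ - 1) * 2 ^ (n₂ + m₂ - 1)) := by
      rw [← pow_add, ← pow_succ']
      congr 1
      omega
    rw [hp]
    have ha : |intDecode x| ≤ 2 ^ (n₁ + m₁ - 1) := abs_le.2 ⟨a1, a2.le⟩
    have hb : |intDecode y| ≤ 2 ^ (n₂ + m₂ - 1) := abs_le.2 ⟨b1, b2.le⟩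
    have hab := mul_le_mul ha hb (abs_nonneg _) (by positivity)
    rw [← abs_mul] at hab
    have hpos : (0 : ℤ) < 2 ^ (n₁ + m₁ - 1) * 2 ^ (n₂ + m₂ - 1) := by positivity
    have := abs_le.1 hab
    linarith

theorem decode_boxdot {n₁ m₁ n₂ m₂ n m : ℕ} (x : BitStr n₁ m₁) (y : BitStr n₂ m₂)
    (hn : n = n₁ + n₂) (hm : m = m₁ + m₂) (h1 : 1 ≤ n₁) (h2 : 1 ≤ n₂) :
    decode (boxdot x y hn hm) = decode x * decode y := by
  have h := decode_mul_two_pow (boxdot x y hn hm)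
  rw [intDecode_boxdot x y hn hm h1 h2, Int.cast_mul, ← decode_mul_two_pow,
    ← decode_mul_two_pow] at h
  subst hm
  rw [pow_add] at h
  have : (0 : ℚ) < 2 ^ m₁ * 2 ^ m₂ := by positivity
  refine mul_right_cancel₀ this.ne' (h.trans ?_)
  ring

/-- Brought to the common denominator 2^m, each summand is at most 2^(n+m-2) in absolute value; the
additional leading bit leaves room for twice that. -/
theorem decode_boxplus {n₁ m₁ n₂ m₂ n m : ℕ} (x : BitStr n₁ m₁) (y : BitStr n₂ m₂)
    (hn : n = max n₁ n₂ + 1) (hm : m = max m₁ m₂) (h1 : 1 ≤ n₁) (h2 : 1 ≤ n₂) :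
    decode (boxplus x y hn hm) = decode x + decode y := by
  obtain ⟨a1, a2⟩ := intDecode_mem h1 x
  obtain ⟨b1, b2⟩ := intDecode_mem h2 y
  have hx := decode_mul_two_pow x
  have hy := decode_mul_two_pow y
  have hm1 : m₁ ≤ m := by omega
  have hm2 : m₂ ≤ m := by omega
  refine decode_encode (z := intDecode x * 2 ^ (m - m₁) + intDecode y * 2 ^ (m - m₂)) (by omega)
    ?_ ?_ ?_
  · push_cast
    rw [← hx, ← hy, mul_assoc, mul_assoc, ← pow_add, ← pow_add, Nat.add_sub_cancel' hm1,
      Nat.add_sub_cancel' hm2]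
    ring
  all_goals
    have e1 : (2 : ℤ) ^ (n₁ + m₁ - 1) * 2 ^ (m - m₁) ≤ 2 ^ (n + m - 2) := by
      rw [← pow_add]
      exact pow_le_pow_right₀ (by norm_num) (by omega)
    have e2 : (2 : ℤ) ^ (n₂ + m₂ - 1) * 2 ^ (m - m₂) ≤ 2 ^ (n + m - 2) := by
      rw [← pow_add]
      exact pow_le_pow_right₀ (by norm_num) (by omega)
    have e3 : (2 : ℤ) ^ (n + m - 1) = 2 * 2 ^ (n + m - 2) := by
      rw [← pow_succ']
      congr 1
      omega
    have p1 : (0 : ℤ) < 2 ^ (m - m₁) := by positivity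
    have p2 : (0 : ℤ) < 2 ^ (m - m₂) := by positivity
    rw [e3]
    nlinarith

theorem decode_bigBoxplus {n m r : ℕ} (hn : 1 ≤ n) (hr : 1 ≤ r) (c : Fin r → BitStr n m) :
    decode (bigBoxplus c) = ∑ j, decode (c j) := by
  induction r with
  | zero => omega
  | succ r ih =>
    cases r with
    | zero => simp [bigBoxplus]
    | succ r =>
      rw [bigBoxplus, decode_boxplus _ _ _ _ (by omega) hn, ih (by omega)]
      exact (Fin.sum_univ_castSucc fun j => decode (c j)).symm

theorem decode_mul_two_pow_add {n m k : ℕ} (x : BitStr n m) :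
    decode x * 2 ^ (k + m) = intDecode x * 2 ^ k := by
  rw [add_comm, pow_add, ← mul_assoc, decode_mul_two_pow]

/-- The products already have m₁ + m₂ fractional bits but `b` only m₂, whence the factor 2^m₁. -/
theorem intDecode_affineStr {d n₁ n₂ m₁ m₂ : ℕ} (hd : 1 ≤ d) (hn₁ : 1 ≤ n₁) (hn₂ : 1 ≤ n₂)
    (a : Fin d → BitStr n₂ m₂) (b : BitStr n₂ m₂) (i : Fin d → BitStr n₁ m₁) :
    intDecode (affineStr hd a b i) =
      ∑ j, intDecode (a j) * intDecode (i j) + intDecode b * 2 ^ m₁ := by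
  have h := decode_mul_two_pow (affineStr hd a b i)
  rw [affineStr, decode_boxplus _ _ _ _ (by omega) hn₂, decode_bigBoxplus (by omega) hd] at h
  have : ∀ j, decode (boxdot (a j) (i j) (by omega) (by omega) : BitStr (n₁ + n₂) (m₁ + m₂)) *
      2 ^ (m₁ + m₂) = intDecode (a j) * intDecode (i j) := fun j => by
    rw [decode_mul_two_pow, intDecode_boxdot _ _ _ _ hn₂ hn₁, Int.cast_mul]
  rw [add_mul, Finset.sum_mul, Finset.sum_congr rfl fun j _ => this j,
    decode_mul_two_pow_add] at h
  rw [affineStr, ← Int.cast_inj (α := ℚ), ← h]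
  push_cast
  rfl

/-- The maximum is attained, so it is the value of a string of the same format and is encoded
exactly. -/
theorem decode_maxStr {n m r : ℕ} (hn : 1 ≤ n) (hr : 1 ≤ r) (x : Fin r → BitStr n m) :
    decode (maxStr hr x) = Finset.univ.sup' ⟨⟨0, hr⟩, Finset.mem_univ _⟩ fun l => decode (x l) := by
  obtain ⟨l, -, hl⟩ := Finset.exists_mem_eq_sup' (s := Finset.univ)
    ⟨⟨0, hr⟩, Finset.mem_univ _⟩ fun l => decode (x l)
  rw [maxStr, hl]
  exact decode_encode hn (decode_mul_two_pow (x l)) (intDecode_mem hn _).1 (intDecode_mem hn _).2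

theorem decode_cast {n n' m : ℕ} (h : n + m = n' + m) (x : BitStr n' m) :
    decode (n := n) (m := m) (fun t => x (Fin.cast h t)) = decode x := by
  obtain rfl : n = n' := by omega
  rfl

theorem decode_payoffStr {d n₁ n₂ m₁ m₂ K : ℕ} {I : Fin K → ℕ} (hd : 1 ≤ d) (hK : 1 ≤ K)
    (hI : ∀ k, 1 ≤ I k) (ξ : Fin K → ℤ)
    (hξ : ∀ k, ξ k = -1 ∨ ξ k = 1) (a : (k : Fin K) → Fin (I k) → Fin d → BitStr n₂ m₂)
    (b : (k : Fin K) → Fin (I k) → BitStr n₂ m₂) (i : Fin d → BitStr n₁ m₁) :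
    decode (payoffStr hd hI ξ a b i) =
      ∑ k, ξ k * decode (maxStr (hI k) fun l => affineStr hd (a k l) (b k l) i) := by
  refine (decode_cast (n' := n₁ + n₂ + d + 2 + K - 1) (by omega) _).trans ?_
  rw [decode_bigBoxplus (by omega) hK]
  refine Finset.sum_congr rfl fun k _ => ?_
  rw [decode_boxdot _ _ _ _ (by norm_num) (by omega),
    decode_encode (m := 0) (by norm_num) (y := (ξ k : ℚ)) (z := ξ k) (by simp)]
  all_goals rcases hξ k with h | h <;> simp [h]

/-- An attained upper bound is the maximum; this is the form in which the reversible program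
delivers its result. -/
theorem intDecode_maxStr_eq {n m r : ℕ} (hn : 1 ≤ n) (hr : 1 ≤ r) (x : Fin r → BitStr n m)
    {v : ℤ} (h1 : ∀ l, intDecode (x l) ≤ v) (h2 : ∃ l, intDecode (x l) = v) :
    decode (maxStr hr x) * 2 ^ m = v := by
  obtain ⟨l₀, hl₀⟩ := h2
  have hm : (0 : ℚ) < 2 ^ m := by positivity
  have : decode (maxStr hr x) = decode (x l₀) := by
    rw [decode_maxStr hn]
    refine le_antisymm (Finset.sup'_le _ _ fun l _ => ?_)
      (Finset.le_sup' (fun l => decode (x l)) (Finset.mem_univ l₀))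
    rw [← mul_le_mul_iff_left₀ hm, decode_mul_two_pow, decode_mul_two_pow, hl₀]
    exact_mod_cast h1 l
  rw [this, decode_mul_two_pow, hl₀]

/-! # The reversible program for maxima of affine functions -/

/-- The wires of the program: input bits `α`, auxiliary bits, and one register of `u + 2` bits for
each element of `β`. -/
inductive Wire (α β : Type) (u : ℕ) : Type
  | inp (i : α)
  | one
  | flag
  | carry (j : Fin (u + 2))
  | reg (r : β) (j : Fin (u + 2))
  deriving DecidableEq

namespace Wire

variable {α β : Type} {u : ℕ}

/-- The sign bit of a register. -/
def signBit (r : β) : Wire α β u := reg r (Fin.last (u + 1))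

/-- The other bits of a register, the least significant one first. -/
def lowBits (r : β) : List (Wire α β u) := (List.finRange (u + 1)).map fun j => reg r j.castSucc

/-- The carry bits. -/
def carries : List (Wire α β u) := (List.finRange (u + 2)).map carry

/-- The signed value of a register. -/
def regVal (r : β) (x : Wire α β u → Fin 2) : ℤ := signedVal (lowBits r) (signBit r) x

theorem mem_lowBits_append {r : β} {q : Wire α β u} :
    q ∈ lowBits r ++ [signBit r] ↔ ∃ j, q = reg r j := by
  simp only [lowBits, signBit, List.mem_append, List.mem_map, List.mem_finRange, true_and,
    List.mem_singleton]
  constructor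
  · rintro (⟨j, rfl⟩ | rfl)
    · exact ⟨_, rfl⟩
    · exact ⟨_, rfl⟩
  · rintro ⟨j, rfl⟩
    refine Fin.lastCases (Or.inr rfl) (fun j => Or.inl ⟨j, rfl⟩) j

theorem mem_carries {q : Wire α β u} : q ∈ carries ↔ ∃ j, q = carry j := by
  simp [carries, eq_comm]

theorem nodup_lowBits_append (r : β) : (lowBits r ++ [signBit r] : List (Wire α β u)).Nodup := by
  rw [List.nodup_append]
  refine ⟨(List.nodup_finRange _).map fun i j h => ?_, List.nodup_singleton _, ?_⟩
  · simpa using h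
  · intro p hp q hq
    simp only [lowBits, List.mem_map, List.mem_singleton] at hp hq
    obtain ⟨j, -, rfl⟩ := hp
    rw [hq, signBit]
    intro h
    injection h with h1 h2
    exact (Fin.castSucc_lt_last j).ne h2

theorem nodup_carries : (carries : List (Wire α β u)).Nodup :=
  (List.nodup_finRange _).map fun i j h => by simpa using h

theorem length_lowBits (r : β) : (lowBits r : List (Wire α β u)).length = u + 1 := by
  simp [lowBits]

theorem length_carries : (carries : List (Wire α β u)).length = u + 2 := by
  simp [carries]

theorem nodup_reg_carries (r : β) :
    ((lowBits r ++ [signBit r]) ++ carries : List (Wire α β u)).Nodup := by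
  refine List.nodup_append.2 ⟨nodup_lowBits_append r, nodup_carries, fun p hp q hq => ?_⟩
  obtain ⟨j, rfl⟩ := mem_lowBits_append.1 hp
  obtain ⟨j', rfl⟩ := mem_carries.1 hq
  simp

theorem regVal_congr {r : β} {x y : Wire α β u → Fin 2} (h : ∀ j, x (reg r j) = y (reg r j)) :
    regVal r x = regVal r y := by
  refine signedVal_congr (fun q hq => ?_) (h _)
  obtain ⟨j, rfl⟩ := mem_lowBits_append.1 (List.mem_append_left [signBit r] hq)
  exact h j

end Wire

open Wire

variable {α β : Type} {u : ℕ}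

/-- The auxiliary bits have their initial values. -/
structure Clean (x : Wire α β u → Fin 2) : Prop where
  one : x one = 1
  flag : x flag = 0
  carry : ∀ j, x (carry j) = 0

theorem Clean.of_frame {x y : Wire α β u → Fin 2} (hx : Clean x)
    (h : ∀ q, (∀ r j, q ≠ reg r j) → y q = x q) : Clean y :=
  ⟨(h _ (by simp)).trans hx.one, (h _ (by simp)).trans hx.flag,
    fun j => (h _ (by simp)).trans (hx.carry j)⟩

variable [Fintype α]

/-- An affine function of the input bits. -/
def affineForm (A : α → ℤ) (B : ℤ) (v : α → Fin 2) : ℤ := ∑ i, ((v i).val : ℤ) * A i + B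

/-- The affine function as a linear form in the wires, one of which holds the bit `1`. -/
def affineTerms (A : α → ℤ) (B : ℤ) : List (Wire α β u × ℤ) :=
  (Finset.univ : Finset α).toList.map (fun i => (inp i, A i)) ++ [(one, B)]

theorem linSum_affineTerms (A : α → ℤ) (B : ℤ) (x : Wire α β u → Fin 2) (h : x one = 1) :
    linSum (affineTerms A B) x = affineForm A B (x ∘ inp) := by
  simp only [linSum, affineTerms, affineForm, List.map_append, List.sum_append, List.map_map,
    List.map_cons, List.map_nil, List.sum_singleton, h]
  rw [← Finset.sum_map_toList]
  simp [Function.comp_def]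

theorem mem_affineTerms {A : α → ℤ} {B : ℤ} {p : Wire α β u × ℤ}
    (h : p ∈ affineTerms A B) : p.1 = one ∨ ∃ i, p.1 = inp i := by
  simp only [affineTerms, List.mem_append, List.mem_map, List.mem_singleton] at h
  rcases h with ⟨i, -, rfl⟩ | rfl
  · exact Or.inr ⟨i, rfl⟩
  · exact Or.inl rfl

theorem length_affineTerms (A : α → ℤ) (B : ℤ) :
    (affineTerms A B : List (Wire α β u × ℤ)).length = Fintype.card α + 1 := by
  simp [affineTerms]

/-! ### Loading and maximizing affine functions in registers -/

section Programs

variable [DecidableEq α] [DecidableEq β]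

theorem run_linProg_reg (A : α → ℤ) (B : ℤ) (r : β) (x : Wire α β u → Fin 2) (hx : Clean x)
    (h0 : ∀ j, x (reg r j) = 0) (hv1 : -2 ^ u ≤ affineForm A B (x ∘ inp))
    (hv2 : affineForm A B (x ∘ inp) < 2 ^ u) :
    (∀ q, (∀ j, q ≠ reg r j) →
      run (linProg (affineTerms A B) (lowBits r ++ [signBit r]) carries) x q = x q) ∧
      regVal r (run (linProg (affineTerms A B) (lowBits r ++ [signBit r]) carries) x) =
        affineForm A B (x ∘ inp) := by
  have hp : (0 : ℤ) < 2 ^ u := by positivity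
  obtain ⟨hf, hval⟩ := run_linProg (affineTerms A B) (lowBits r ++ [signBit r]) carries x
    (nodup_reg_carries r) (fun p hp => by
      rw [List.mem_append, mem_lowBits_append, mem_carries]
      rcases mem_affineTerms hp with h | ⟨i, h⟩ <;> simp [h])
    (by simp [length_lowBits, length_carries])
    (fun q hq => by obtain ⟨j, rfl⟩ := mem_carries.1 hq; exact hx.carry j)
  refine ⟨fun q hq => hf q fun h => ?_, signedVal_eq_of_modEq ?_ ?_ ?_⟩
  · obtain ⟨j, rfl⟩ := mem_lowBits_append.1 h
    exact hq j rfl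
  · refine hval.trans (modEq_of_eq ?_)
    rw [linSum_affineTerms _ _ _ hx.one, bitVal_eq_zero, zero_add]
    intro q hq
    obtain ⟨j, rfl⟩ := mem_lowBits_append.1 hq
    exact h0 j
  · rw [length_lowBits, pow_succ]; linarith
  · rw [length_lowBits, pow_succ]; linarith

/-- Replace the value of the register `r` by its maximum with an affine function, using the
register `r'`. -/
def maxRegProg (A : α → ℤ) (B : ℤ) (r r' : β) : List (RevGate (Wire α β u)) :=
  maxProg (affineTerms A B) (lowBits r) (signBit r) (lowBits r') (signBit r') flag carries

theorem run_maxRegProg (A : α → ℤ) (B : ℤ) {r r' : β} (hr : r ≠ r') (x : Wire α β u → Fin 2)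
    (hx : Clean x) (h0 : ∀ j, x (reg r' j) = 0) (hv1 : -2 ^ u ≤ affineForm A B (x ∘ inp))
    (hv2 : affineForm A B (x ∘ inp) < 2 ^ u) (hr1 : -2 ^ u ≤ regVal r x)
    (hr2 : regVal r x < 2 ^ u) :
    (∀ q, (∀ j, q ≠ reg r j) → (∀ j, q ≠ reg r' j) → run (maxRegProg A B r r') x q = x q) ∧
      regVal r (run (maxRegProg A B r r') x) = max (regVal r x) (affineForm A B (x ∘ inp)) := by
  have hlin := linSum_affineTerms (u := u) (β := β) A B x hx.one
  obtain ⟨hf, hval⟩ := run_maxProg (affineTerms A B) (lowBits r) (signBit r) (lowBits r')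
    (signBit r') flag carries x u (length_lowBits r) (length_lowBits r') length_carries
    (by
      rw [List.nodup_cons, List.nodup_append (l₁ := lowBits r ++ [signBit r])]
      refine ⟨?_, nodup_lowBits_append r, nodup_reg_carries r', fun p hp q hq => ?_⟩
      · rw [List.mem_append, List.mem_append (s := lowBits r' ++ [signBit r']), mem_lowBits_append,
          mem_lowBits_append, mem_carries]
        simp
      · rw [List.mem_append, mem_lowBits_append, mem_carries] at hq
        obtain ⟨j, rfl⟩ := mem_lowBits_append.1 hp
        rcases hq with ⟨j', rfl⟩ | ⟨j', rfl⟩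
        · simp [hr]
        · simp)
    (fun p hp => by
      rw [List.mem_append, List.mem_append (s := lowBits r' ++ [signBit r']), mem_lowBits_append,
        mem_lowBits_append, mem_carries]
      rcases mem_affineTerms hp with h | ⟨i, h⟩ <;> simp [h])
    (fun q hq => by
      rw [List.mem_cons, List.mem_append, mem_lowBits_append, mem_carries] at hq
      rcases hq with rfl | ⟨j, rfl⟩ | ⟨j, rfl⟩
      · exact hx.flag
      · exact h0 j
      · exact hx.carry j)
    (hlin ▸ hv1) (hlin ▸ hv2) hr1 hr2
  refine ⟨fun q hq hq' => hf q fun h => ?_, by rw [← hlin]; exact hval⟩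
  rw [List.mem_append, mem_lowBits_append, mem_lowBits_append] at h
  rcases h with ⟨j, h⟩ | ⟨j, h⟩
  · exact hq j h
  · exact hq' j h

/-- Each step consumes one fresh register and returns flag and carries clean. The result is
described as an upper bound that is attained, which passes through the induction without naming an
iterated maximum. -/
theorem run_flatMap_maxRegProg (A : β → α → ℤ) (B : β → ℤ) (r : β) (rs : List β)
    (hnd : (r :: rs).Nodup) (x : Wire α β u → Fin 2) (hx : Clean x)
    (h0 : ∀ r' ∈ rs, ∀ j, x (reg r' j) = 0)
    (hv : ∀ r', -2 ^ u ≤ affineForm (A r') (B r') (x ∘ inp) ∧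
      affineForm (A r') (B r') (x ∘ inp) < 2 ^ u)
    (hr1 : -2 ^ u ≤ regVal r x) (hr2 : regVal r x < 2 ^ u) {y : Wire α β u → Fin 2}
    (hy : y = run (rs.flatMap fun r' => maxRegProg (A r') (B r') r r') x) :
    (∀ q, (∀ r' ∈ r :: rs, ∀ j, q ≠ reg r' j) → y q = x q) ∧ regVal r x ≤ regVal r y ∧
      (∀ r' ∈ rs, affineForm (A r') (B r') (x ∘ inp) ≤ regVal r y) ∧
      (regVal r y = regVal r x ∨ ∃ r' ∈ rs, regVal r y = affineForm (A r') (B r') (x ∘ inp)) := by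
  induction rs generalizing x with
  | nil => simp_all
  | cons r' rs ih =>
    have hrr' : r ≠ r' := by
      rintro rfl
      simp at hnd
    obtain ⟨hf, hval⟩ := run_maxRegProg (A r') (B r') hrr' x hx (h0 r' (by simp)) (hv r').1
      (hv r').2 hr1 hr2
    rw [List.flatMap_cons, run_append] at hy
    set z := run (maxRegProg (A r') (B r') r r') x with hz
    have hzx : z ∘ inp = x ∘ inp := funext fun i => hf _ (by simp) (by simp)
    simp only [List.nodup_cons, List.mem_cons, not_or] at hnd
    obtain ⟨e1, e2, e3, e4⟩ := ih (by simp [hnd]) z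
      (hx.of_frame fun q hq => hf q (hq r) (hq r'))
      (fun r'' h'' j => by
        rw [hf _ _ _, h0 r'' (List.mem_cons_of_mem _ h'') j]
        · rintro j' h
          injection h with h _
          exact hnd.1.2 (h ▸ h'')
        · rintro j' h
          injection h with h _
          exact hnd.2.1 (h ▸ h''))
      (by rwa [hzx]) (hval ▸ le_max_of_le_left hr1) (hval ▸ max_lt hr2 (hv r').2) hy
    rw [hzx] at e3 e4
    refine ⟨fun q hq => ?_, ?_, ?_, ?_⟩
    · rw [e1 q fun r'' h'' => hq r'' ?_, hf q (hq r (by simp)) (hq r' (by simp))]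
      rcases List.mem_cons.1 h'' with rfl | h''
      · simp
      · simp [h'']
    · exact le_trans (hval ▸ le_max_left _ _) e2
    · intro r'' h''
      rcases List.mem_cons.1 h'' with rfl | h''
      · exact le_trans (hval ▸ le_max_right _ _) e2
      · exact e3 r'' h''
    · rcases e4 with e4 | ⟨r'', h'', e4⟩
      · rw [e4, hval]
        rcases max_choice (regVal r x) (affineForm (A r') (B r') (x ∘ inp)) with h | h
        · exact Or.inl h
        · exact Or.inr ⟨r', by simp, h⟩
      · exact Or.inr ⟨r'', by simp [h''], e4⟩

end Programs

/-! ### One maximum for each index k -/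

section Groups

variable {K : ℕ} {I : Fin K → ℕ}

/-- The first register of a group. -/
def firstReg (hI : ∀ k, 1 ≤ I k) (k : Fin K) : Σ k : Fin K, Fin (I k) := ⟨k, ⟨0, hI k⟩⟩

/-- The other registers of a group. -/
def otherRegs (hI : ∀ k, 1 ≤ I k) (k : Fin K) : List (Σ k : Fin K, Fin (I k)) :=
  ((List.finRange (I k)).erase ⟨0, hI k⟩).map fun l => ⟨k, l⟩

theorem mem_firstReg_cons_otherRegs (hI : ∀ k, 1 ≤ I k) (k : Fin K)
    (r : Σ k : Fin K, Fin (I k)) : r ∈ firstReg hI k :: otherRegs hI k ↔ ∃ l, r = ⟨k, l⟩ := by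
  simp only [firstReg, otherRegs, List.mem_cons, List.mem_map,
    (List.nodup_finRange (I k)).mem_erase_iff, List.mem_finRange, and_true]
  constructor
  · rintro (rfl | ⟨l, -, rfl⟩)
    · exact ⟨_, rfl⟩
    · exact ⟨_, rfl⟩
  · rintro ⟨l, rfl⟩
    by_cases h : l = ⟨0, hI k⟩
    · exact Or.inl (by rw [h])
    · exact Or.inr ⟨l, h, rfl⟩

theorem nodup_firstReg_cons_otherRegs (hI : ∀ k, 1 ≤ I k) (k : Fin K) :
    (firstReg hI k :: otherRegs hI k).Nodup := by
  rw [List.nodup_cons]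
  refine ⟨?_, (((List.nodup_finRange (I k)).erase _).map fun l l' h => by simpa using h)⟩
  simp only [firstReg, otherRegs, List.mem_map, (List.nodup_finRange (I k)).mem_erase_iff]
  rintro ⟨l, ⟨h, -⟩, h'⟩
  exact h (by simpa using h')

theorem length_otherRegs (hI : ∀ k, 1 ≤ I k) (k : Fin K) :
    (otherRegs hI k).length = I k - 1 := by
  simp [otherRegs, List.length_erase_of_mem]

/-- Compute the maximum of the affine functions of a group into its first register. -/
def groupProg (hI : ∀ k, 1 ≤ I k) (A : (Σ k : Fin K, Fin (I k)) → α → ℤ)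
    (B : (Σ k : Fin K, Fin (I k)) → ℤ) (k : Fin K) :
    List (RevGate (Wire α (Σ k : Fin K, Fin (I k)) u)) :=
  linProg (affineTerms (A (firstReg hI k)) (B (firstReg hI k)))
      (lowBits (firstReg hI k) ++ [signBit (firstReg hI k)]) carries ++
    (otherRegs hI k).flatMap fun r' => maxRegProg (A r') (B r') (firstReg hI k) r'

/-- The first register is loaded with its own affine function rather than compared with its initial
0, since the maximum may be negative. -/
theorem run_groupProg [DecidableEq α] (hI : ∀ k, 1 ≤ I k) (A : (Σ k : Fin K, Fin (I k)) → α → ℤ)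
    (B : (Σ k : Fin K, Fin (I k)) → ℤ) (k : Fin K)
    (x : Wire α (Σ k : Fin K, Fin (I k)) u → Fin 2) (hx : Clean x)
    (h0 : ∀ l j, x (reg ⟨k, l⟩ j) = 0)
    (hv : ∀ r, -2 ^ u ≤ affineForm (A r) (B r) (x ∘ inp) ∧
      affineForm (A r) (B r) (x ∘ inp) < 2 ^ u) :
    (∀ q, (∀ l j, q ≠ reg ⟨k, l⟩ j) → run (groupProg hI A B k) x q = x q) ∧
      (∀ l, affineForm (A ⟨k, l⟩) (B ⟨k, l⟩) (x ∘ inp) ≤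
        regVal (firstReg hI k) (run (groupProg hI A B k) x)) ∧
      ∃ l, affineForm (A ⟨k, l⟩) (B ⟨k, l⟩) (x ∘ inp) =
        regVal (firstReg hI k) (run (groupProg hI A B k) x) := by
  obtain ⟨hf, hval⟩ := run_linProg_reg (A (firstReg hI k)) (B (firstReg hI k)) (firstReg hI k) x hx
    (h0 _) (hv _).1 (hv _).2
  rw [groupProg, run_append]
  set z := run (linProg (affineTerms (A (firstReg hI k)) (B (firstReg hI k)))
      (lowBits (firstReg hI k) ++ [signBit (firstReg hI k)]) carries) x with hz
  have hzx : z ∘ inp = x ∘ inp := funext fun i => hf _ (by simp)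
  have hnd := nodup_firstReg_cons_otherRegs hI k
  obtain ⟨e1, e2, e3, e4⟩ := run_flatMap_maxRegProg A B (firstReg hI k) (otherRegs hI k) hnd z
    (hx.of_frame fun q hq => hf q (hq _))
    (fun r' hr' j => by
      rw [hf]
      · obtain ⟨l, rfl⟩ := (mem_firstReg_cons_otherRegs hI k r').1 (List.mem_cons_of_mem _ hr')
        exact h0 l j
      · intro j' h
        injection h with h _
        exact (List.nodup_cons.1 hnd).1 (h ▸ hr'))
    (by rwa [hzx]) (hval ▸ (hv _).1) (hval ▸ (hv _).2) rfl
  set y := run ((otherRegs hI k).flatMap fun r' => maxRegProg (A r') (B r') (firstReg hI k) r') z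
    with hy
  rw [hzx] at e3 e4
  rw [hval] at e2 e4
  refine ⟨fun q hq => ?_, fun l => ?_, ?_⟩
  · rw [e1 q, hf q (hq _)]
    intro r' hr'
    obtain ⟨l, rfl⟩ := (mem_firstReg_cons_otherRegs hI k r').1 hr'
    exact hq l
  · rcases List.mem_cons.1 ((mem_firstReg_cons_otherRegs hI k ⟨k, l⟩).2 ⟨l, rfl⟩) with h | h
    · rw [h]; exact e2
    · exact e3 _ h
  · rcases e4 with e4 | ⟨r', hr', e4⟩
    · exact ⟨_, e4.symm⟩
    · obtain ⟨l, rfl⟩ := (mem_firstReg_cons_otherRegs hI k r').1 (List.mem_cons_of_mem _ hr')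
      exact ⟨l, e4.symm⟩

/-- Groups share only the inputs, the constant bit, and the flag and carries, which come back clean.
Their registers are disjoint, so a finished maximum survives the later groups. -/
theorem run_flatMap_groupProg [DecidableEq α] (hI : ∀ k, 1 ≤ I k) (A : (Σ k : Fin K, Fin (I k)) → α → ℤ)
    (B : (Σ k : Fin K, Fin (I k)) → ℤ) (ks : List (Fin K)) (hks : ks.Nodup)
    (x : Wire α (Σ k : Fin K, Fin (I k)) u → Fin 2) (hx : Clean x)
    (h0 : ∀ k ∈ ks, ∀ l j, x (reg ⟨k, l⟩ j) = 0)
    (hv : ∀ r, -2 ^ u ≤ affineForm (A r) (B r) (x ∘ inp) ∧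
      affineForm (A r) (B r) (x ∘ inp) < 2 ^ u) {y : Wire α (Σ k : Fin K, Fin (I k)) u → Fin 2}
    (hy : y = run (ks.flatMap (groupProg hI A B)) x) :
    (∀ q, (∀ k ∈ ks, ∀ l j, q ≠ reg ⟨k, l⟩ j) → y q = x q) ∧ ∀ k ∈ ks,
      (∀ l, affineForm (A ⟨k, l⟩) (B ⟨k, l⟩) (x ∘ inp) ≤ regVal (firstReg hI k) y) ∧
      ∃ l, affineForm (A ⟨k, l⟩) (B ⟨k, l⟩) (x ∘ inp) = regVal (firstReg hI k) y := by
  induction ks generalizing x with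
  | nil => simp_all
  | cons k ks ih =>
    obtain ⟨hf, hval⟩ := run_groupProg hI A B k x hx (h0 k (by simp)) hv
    rw [List.flatMap_cons, run_append] at hy
    set z := run (groupProg hI A B k) x with hz
    have hzx : z ∘ inp = x ∘ inp := funext fun i => hf _ (by simp)
    rw [List.nodup_cons] at hks
    obtain ⟨e1, e2⟩ := ih hks.2 z (hx.of_frame fun q hq => hf q fun l => hq _)
      (fun k' hk' l j => by
        rw [hf, h0 k' (List.mem_cons_of_mem _ hk')]
        intro l' j' h
        injection h with h _
        injection h with h _
        exact hks.1 (h ▸ hk'))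
      (by rwa [hzx]) hy
    rw [hzx] at e2
    refine ⟨fun q hq => ?_, fun k' hk' => ?_⟩
    · rw [e1 q fun k' hk' => hq k' (List.mem_cons_of_mem _ hk'), hf q (hq k (by simp))]
    · rcases List.mem_cons.1 hk' with rfl | hk'
      · rwa [regVal_congr (y := z)]
        intro j
        refine e1 _ fun k'' hk'' l j h => ?_
        injection h with h _
        injection h with h _
        exact hks.1 (h ▸ hk'')
      · exact e2 k' hk'

/-- Compute all group maxima, starting from registers and auxiliary bits that are `0`. -/
def payoffProg (hI : ∀ k, 1 ≤ I k) (A : (Σ k : Fin K, Fin (I k)) → α → ℤ)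
    (B : (Σ k : Fin K, Fin (I k)) → ℤ) : List (RevGate (Wire α (Σ k : Fin K, Fin (I k)) u)) :=
  .not one :: (List.finRange K).flatMap (groupProg hI A B)

theorem run_payoffProg [DecidableEq α] (hI : ∀ k, 1 ≤ I k) (A : (Σ k : Fin K, Fin (I k)) → α → ℤ)
    (B : (Σ k : Fin K, Fin (I k)) → ℤ) (x : Wire α (Σ k : Fin K, Fin (I k)) u → Fin 2)
    (h0 : ∀ q, (∀ i, q ≠ inp i) → x q = 0)
    (hv : ∀ r, -2 ^ u ≤ affineForm (A r) (B r) (x ∘ inp) ∧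
      affineForm (A r) (B r) (x ∘ inp) < 2 ^ u) {y : Wire α (Σ k : Fin K, Fin (I k)) u → Fin 2}
    (hy : y = run (payoffProg hI A B) x) :
    y ∘ inp = x ∘ inp ∧ ∀ k,
      (∀ l, affineForm (A ⟨k, l⟩) (B ⟨k, l⟩) (x ∘ inp) ≤ regVal (firstReg hI k) y) ∧
      ∃ l, affineForm (A ⟨k, l⟩) (B ⟨k, l⟩) (x ∘ inp) = regVal (firstReg hI k) y := by
  rw [payoffProg, run_cons] at hy
  set z := (RevGate.not one).run x with hz
  have hzq : ∀ q, q ≠ one → z q = x q := fun q hq => by simp [hz, RevGate.run, hq]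
  have hzx : z ∘ inp = x ∘ inp := funext fun i => hzq _ (by simp)
  have hclean : Clean z :=
    ⟨by simp [hz, RevGate.run, h0], by rw [hzq _ (by simp), h0 _ (by simp)],
      fun j => by rw [hzq _ (by simp), h0 _ (by simp)]⟩
  obtain ⟨e1, e2⟩ := run_flatMap_groupProg hI A B (List.finRange K) (List.nodup_finRange K) z hclean
    (fun k _ l j => by rw [hzq _ (by simp), h0 _ (by simp)]) (by rwa [hzx]) hy
  rw [hzx] at e2
  exact ⟨funext fun i => (e1 _ (by simp)).trans (congrFun hzx i),
    fun k => e2 k (List.mem_finRange k)⟩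

theorem length_flatMap_le {γ δ : Type*} {c : ℕ} (l : List γ) (g : γ → List δ)
    (h : ∀ a ∈ l, (g a).length ≤ c) : (l.flatMap g).length ≤ l.length * c := by
  induction l with
  | nil => simp
  | cons a l ih =>
    have h1 := h a (by simp)
    have h2 := ih fun b hb => h b (List.mem_cons_of_mem _ hb)
    simp only [List.flatMap_cons, List.length_append, List.length_cons, Nat.succ_mul]
    omega

/-- One comparison costs at most `c`, and so does loading the first register; a group has I_k - 1
comparisons and one load. -/
theorem length_payoffProg (hI : ∀ k, 1 ≤ I k) (A : (Σ k : Fin K, Fin (I k)) → α → ℤ)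
    (B : (Σ k : Fin K, Fin (I k)) → ℤ) :
    (payoffProg hI A B : List (RevGate (Wire α (Σ k : Fin K, Fin (I k)) u))).length ≤
      K * (Finset.univ.sup I *
        ((Fintype.card α + 2 * (u + 2)) * (3 * (u + 2) ^ 2) + 2 * (u + 2))) + 1 := by
  rw [payoffProg, List.length_cons]
  refine Nat.succ_le_succ ((length_flatMap_le _ _ fun k _ => ?_).trans_eq
    (by rw [List.length_finRange]))
  set c := (Fintype.card α + 2 * (u + 2)) * (3 * (u + 2) ^ 2) + 2 * (u + 2) with hc
  have h1 := length_linProg (affineTerms (A (firstReg hI k)) (B (firstReg hI k)))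
    (lowBits (firstReg hI k) ++ [signBit (firstReg hI k)] :
      List (Wire α (Σ k : Fin K, Fin (I k)) u)) carries
  have h2 : ∀ r', (maxRegProg (A r') (B r') (firstReg hI k) r' :
      List (RevGate (Wire α (Σ k : Fin K, Fin (I k)) u))).length ≤ c := fun r' => by
    have := length_maxProg (affineTerms (A r') (B r') :
      List (Wire α (Σ k : Fin K, Fin (I k)) u × ℤ)) (lowBits (firstReg hI k))
      (signBit (firstReg hI k)) (lowBits r') (signBit r') flag carries
      (by rw [length_lowBits, length_lowBits])
    rw [length_affineTerms, length_lowBits] at this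
    refine this.trans ?_
    rw [hc]
    have : Fintype.card α + 1 + 2 * (u + 1) + 1 = Fintype.card α + 2 * (u + 2) := by ring
    rw [this, show u + 1 + 1 = u + 2 from rfl]
    omega
  have h3 := length_flatMap_le (otherRegs hI k) (fun r' => (maxRegProg (A r') (B r')
    (firstReg hI k) r' : List (RevGate (Wire α (Σ k : Fin K, Fin (I k)) u)))) fun r' _ => h2 r'
  rw [length_affineTerms, List.length_append, length_lowBits, List.length_singleton] at h1
  rw [length_otherRegs] at h3
  have h4 : (Fintype.card α + 1) * (3 * (u + 1 + 1) ^ 2) ≤ c := by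
    rw [hc]
    refine le_add_right (Nat.mul_le_mul_right _ (by omega))
  have h5 : I k * c ≤ Finset.univ.sup I * c :=
    Nat.mul_le_mul_right _ (Finset.le_sup (f := I) (Finset.mem_univ k))
  have h6 : (I k - 1) * c + c = I k * c := by
    rw [← Nat.succ_mul]
    congr 1
    have := hI k
    omega
  rw [groupProg, List.length_append]
  omega

/-! # The circuit -/

/-- The program runs first, then every bit of each first register controls a rotation of `t` by σ_k
times its signed place value. The angles add up to ∑ σ_k v_k, so no register for this sum is needed.
-/
theorem exists_circuit_payoff [DecidableEq α] (hI : ∀ k, 1 ≤ I k) (A : (Σ k : Fin K, Fin (I k)) → α → ℤ)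
    (B : (Σ k : Fin K, Fin (I k)) → ℤ) (σ : Fin K → ℝ) {n : ℕ}
    (f : Wire α (Σ k : Fin K, Fin (I k)) u ↪ Fin n) (t : Fin n) (ht : t ∉ Set.range f) :
    ∃ C : Circuit n, C.gateCount ≤ (K * (Finset.univ.sup I *
        ((Fintype.card α + 2 * (u + 2)) * (3 * (u + 2) ^ 2) + 2 * (u + 2))) + 1) * (12 * n + 15) +
        (K * (u + 2) * (4 * n + 4) + 1) ∧
      ∀ y : Fin n → Fin 2, (∀ q, (∀ i, q ≠ inp i) → y (f q) = 0) → y t = 0 →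
        (∀ r, -2 ^ u ≤ affineForm (A r) (B r) (fun i => y (f (inp i))) ∧
          affineForm (A r) (B r) (fun i => y (f (inp i))) < 2 ^ u) →
        ∃ (y' : Fin n → Fin 2) (v : Fin K → ℤ),
          C.matrix.mulVec (ket y) = rotState t y' (∑ k, σ k * v k + Real.pi / 2) ∧
          (∀ i, y' (f (inp i)) = y (f (inp i))) ∧ ∀ k,
            (∀ l, affineForm (A ⟨k, l⟩) (B ⟨k, l⟩) (fun i => y (f (inp i))) ≤ v k) ∧
            ∃ l, affineForm (A ⟨k, l⟩) (B ⟨k, l⟩) (fun i => y (f (inp i))) = v k := by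
  obtain ⟨C, hC1, hC2⟩ := exists_circuit_run (payoffProg hI A B) f
  let terms : Fin K → List (Fin n × ℝ) := fun k =>
    (signedTerms 1 (lowBits (firstReg hI k)) (signBit (firstReg hI k))).map
      fun p => (f p.1, σ k * p.2)
  have hterms : ∀ k (y : Fin n → Fin 2), ((terms k).map fun p => ((y p.1).val : ℝ) * p.2).sum =
      σ k * regVal (firstReg hI k) (y ∘ f) := by
    intro k y
    have h := linSum_signedTerms 1 (lowBits (firstReg hI k)) (signBit (firstReg hI k)) (y ∘ f)
    rw [one_mul] at h
    rw [regVal, ← h, linSum, Int.cast_list_sum, List.map_map, List.map_map, ← List.sum_map_mul_left]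
    congr 1
    refine List.map_congr_left fun p _ => ?_
    simp
    ring
  have hlen : ((List.finRange K).flatMap terms).length ≤ K * (u + 2) := by
    refine (length_flatMap_le _ _ fun k _ => ?_).trans_eq (by rw [List.length_finRange])
    simp [terms, length_signedTerms, length_lowBits]
  obtain ⟨D, hD1, hD2⟩ := (rotatesBy_list (t := t) ((List.finRange K).flatMap terms) (by
    intro p hp
    simp only [terms, List.mem_flatMap, List.mem_map] at hp
    obtain ⟨k, -, q, -, rfl⟩ := hp
    exact fun h => ht ⟨_, h⟩)).comp (rotatesBy_const t (Real.pi / 2))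
  refine ⟨C ++ D, ?_, fun y h0 hyt hv => ?_⟩
  · rw [Circuit.gateCount_append]
    refine Nat.add_le_add (hC1.trans (Nat.mul_le_mul_right _ (length_payoffProg hI A B)))
      (hD1.trans (Nat.succ_le_succ (Nat.mul_le_mul_right _ hlen)))
  · obtain ⟨y', e1, e2, e3⟩ := hC2 y
    obtain ⟨e4, e5⟩ := run_payoffProg hI A B (y ∘ f) h0 hv e2
    refine ⟨y', fun k => regVal (firstReg hI k) (y' ∘ f), ?_, fun i => congrFun e4 i, e5⟩
    -- The program never touches `t`, so its output is a state of angle 0 there.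
    have hket : ket y' = rotState t y' 0 := by
      have : y' t = 0 := (e3 t ht).trans hyt
      simp [rotState, ← this]
    rw [Circuit.matrix_append, ← Matrix.mulVec_mulVec, e1, hket, hD2, zero_add]
    congr 2
    dsimp only
    rw [List.map_flatMap, List.flatMap, List.sum_flatten, List.map_map, Fin.sum_univ_def]
    congr 2
    exact List.map_congr_left fun k _ => hterms k y'

end Groups

/-! # Counting qubits and gates -/

/-- The number of qubits beyond the input registers. -/
def ancillaCount (d n₁ n₂ m₁ m₂ : ℕ) {K : ℕ} (I : Fin K → ℕ) : ℕ :=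
  ∑ k, (I k * (2 * (n₁ + n₂ + (m₁ + m₂) + d) + (d * (2 * n₂ + 2 * m₂ + 3) + (n₂ + m₂) +
    (d - 1) * (n₁ + n₂ + (m₁ + m₂))) + 4) + 6)

/-- With w = n + m + d, the possibly negative term (I_k - 2)w of q_k is compensated by the 2(w + 5)
qubits per k: together they give I_k(2w + p + 4) + 6, a natural number. -/
theorem qubitCount_eq {d n₁ n₂ m₁ m₂ K : ℕ} (I : Fin K → ℕ) (hd : 1 ≤ d) :
    ((d * (n₁ + m₁) + ancillaCount d n₁ n₂ m₁ m₂ I : ℕ) : ℤ) =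
      qubitCount d n₁ n₂ m₁ m₂ I := by
  have e : 2 * (K : ℤ) * ((n₁ + n₂) + (m₁ + m₂) + d + 5) =
      ∑ _k : Fin K, 2 * ((n₁ + n₂ : ℤ) + (m₁ + m₂) + d + 5) := by
    rw [Finset.sum_const, Finset.card_univ, Fintype.card_fin, nsmul_eq_mul]
    ring
  rw [qubitCount, e, add_assoc, ← Finset.sum_add_distrib, ancillaCount]
  push_cast [Nat.cast_sub hd]
  congr 1
  refine Finset.sum_congr rfl fun k _ => ?_
  rw [qCount, pCount]
  ring

/-- With P = d(n+m+1), the inputs need at most P qubits and each k at most 5JP + 6 more. Altogether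
this is at most 12KJP, well below the claim. -/
theorem qubitCount_le {d n₁ n₂ m₁ m₂ K : ℕ} (I : Fin K → ℕ) (hd : 1 ≤ d) (hn₁ : 1 ≤ n₁)
    (hm₁ : 1 ≤ m₁) (hK : 1 ≤ K) (hI : ∀ k, 1 ≤ I k) :
    d * (n₁ + m₁) + ancillaCount d n₁ n₂ m₁ m₂ I ≤
      23 * K * Finset.univ.sup I * d * ((n₁ + n₂) + (m₁ + m₂) + 1) := by
  obtain ⟨e, rfl⟩ : ∃ e, d = e + 1 := ⟨d - 1, by omega⟩
  set L := (n₁ + n₂) + (m₁ + m₂) + 1 with hL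
  set J := Finset.univ.sup I with hJ
  have hIJ : ∀ k, I k ≤ J := fun k => Finset.le_sup (f := I) (Finset.mem_univ k)
  have hJ1 : 1 ≤ J := (hI ⟨0, hK⟩).trans (hIJ _)
  have hsum : ancillaCount (e + 1) n₁ n₂ m₁ m₂ I ≤ K * (J * (5 * ((e + 1) * L)) + 6) := by
    have := Finset.sum_le_card_nsmul Finset.univ (fun k => (I k * (2 * (n₁ + n₂ + (m₁ + m₂) +
      (e + 1)) + ((e + 1) * (2 * n₂ + 2 * m₂ + 3) + (n₂ + m₂) +
      (e + 1 - 1) * (n₁ + n₂ + (m₁ + m₂))) + 4) + 6)) (J * (5 * ((e + 1) * L)) + 6)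
      fun k _ => by
        refine Nat.add_le_add_right (Nat.mul_le_mul (hIJ k) ?_) 6
        rw [hL, Nat.add_sub_cancel]
        nlinarith [Nat.zero_le (e * n₁), Nat.zero_le (e * m₁), Nat.zero_le (e * n₂),
          Nat.zero_le (e * m₂)]
    rwa [Finset.card_univ, Fintype.card_fin, smul_eq_mul] at this
  have hP : 1 ≤ (e + 1) * L := Nat.mul_pos (by omega) (by omega)
  have hKJ : 1 ≤ K * J := Nat.mul_pos hK hJ1
  have h1 : (e + 1) * (n₁ + m₁) ≤ (e + 1) * L := Nat.mul_le_mul_left _ (by omega)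
  have h2 : (e + 1) * L ≤ K * J * ((e + 1) * L) := Nat.le_mul_of_pos_left _ hKJ
  have h3 : K ≤ K * J * ((e + 1) * L) := by
    rw [mul_assoc]
    exact Nat.le_mul_of_pos_right _ (Nat.mul_pos hJ1 hP)
  calc (e + 1) * (n₁ + m₁) + ancillaCount (e + 1) n₁ n₂ m₁ m₂ I
      ≤ K * J * ((e + 1) * L) + (5 * (K * J * ((e + 1) * L)) + 6 * (K * J * ((e + 1) * L))) := by
        refine Nat.add_le_add (h1.trans h2) (hsum.trans ?_)
        rw [mul_add]
        refine Nat.add_le_add (le_of_eq (by ring)) (by omega)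
    _ ≤ 23 * (K * J * ((e + 1) * L)) := by omega
    _ = 23 * K * J * (e + 1) * L := by ring

/-- The left side counts the constant bit and the flag, the carries, all registers of width u + 2 =
n + m + d + 1, and the rotated qubit. -/
theorem card_wires_le {d n₁ n₂ m₁ m₂ K : ℕ} (I : Fin K → ℕ)
    (hK : 1 ≤ K) (hI : ∀ k, 1 ≤ I k) :
    2 + (n₁ + n₂ + (m₁ + m₂) + d + 1) + (∑ k, I k) * (n₁ + n₂ + (m₁ + m₂) + d + 1) + 1 ≤
      ancillaCount d n₁ n₂ m₁ m₂ I := by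
  rw [ancillaCount]
  set w := n₁ + n₂ + (m₁ + m₂) + d
  set p := d * (2 * n₂ + 2 * m₂ + 3) + (n₂ + m₂) + (d - 1) * (n₁ + n₂ + (m₁ + m₂))
  have h1 : ∑ k, (I k * (w + 1) + (w + 4)) ≤ ∑ k, (I k * (2 * w + p + 4) + 6) := by
    refine Finset.sum_le_sum fun k _ => ?_
    nlinarith [hI k, Nat.zero_le (I k * p), Nat.mul_le_mul_right (w + 3) (hI k)]
  rw [Finset.sum_add_distrib, ← Finset.sum_mul, Finset.sum_const, Finset.card_univ,
    Fintype.card_fin, smul_eq_mul] at h1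
  have h2 : w + 4 ≤ K * (w + 4) := Nat.le_mul_of_pos_left _ hK
  omega

/-- Here P = d(n+m+1), Q = KJ, U = u + 2 is the register width and a = d(n₁+m₁) the number of input
bits. The program contributes at most 29 · 291 = 8439 times Q²P⁴; P ≥ 5 absorbs the quadratic cost
of the rotations. -/
theorem gateCount_bound {P Q U a n : ℕ} (hP : 5 ≤ P) (hQ : 1 ≤ Q) (hU : 2 * U ≤ 3 * P)
    (ha : a + 2 * U ≤ 4 * P) (hn : n ≤ 23 * (Q * P)) {K J : ℕ} (hKJ : Q = K * J) (hJ : 1 ≤ J) :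
    (K * (J * ((a + 2 * U) * (3 * U ^ 2) + 2 * U)) + 1) * (12 * n + 15) +
      (K * U * (4 * n + 4) + 1) ≤ 15262 * (Q ^ 2 * P ^ 4) := by
  have hP2 : 25 ≤ P ^ 2 := by nlinarith
  have hU2 : 4 * U ^ 2 ≤ 9 * P ^ 2 := by nlinarith
  have h1 : (a + 2 * U) * (3 * U ^ 2) + 2 * U ≤ 28 * P ^ 3 := by
    have : (a + 2 * U) * (3 * U ^ 2) ≤ 4 * P * (3 * U ^ 2) := Nat.mul_le_mul_right _ ha
    nlinarith
  have hQP : 1 ≤ Q * P := Nat.mul_pos hQ (by omega)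
  have hP3 : P ≤ P ^ 3 := by nlinarith
  have h2 : K * (J * ((a + 2 * U) * (3 * U ^ 2) + 2 * U)) + 1 ≤ 29 * (Q * P ^ 3) := by
    rw [← mul_assoc, ← hKJ]
    have := Nat.mul_le_mul_left Q h1
    have : 1 ≤ Q * P ^ 3 := Nat.mul_pos hQ (by omega)
    nlinarith
  have h3 : 12 * n + 15 ≤ 291 * (Q * P) := by omega
  have h4 : 4 * n + 4 ≤ 96 * (Q * P) := by omega
  have h5 : K * U ≤ 2 * (Q * P) := by
    have : K ≤ Q := by rw [hKJ]; exact Nat.le_mul_of_pos_right _ hJ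
    calc K * U ≤ Q * (2 * P) := Nat.mul_le_mul this (by omega)
      _ = 2 * (Q * P) := by ring
  have h6 := Nat.mul_le_mul h2 h3
  have h7 := Nat.mul_le_mul h5 h4
  have h8 : 25 * (Q * P) ^ 2 ≤ Q ^ 2 * P ^ 4 := by
    calc 25 * (Q * P) ^ 2 ≤ P ^ 2 * (Q * P) ^ 2 := Nat.mul_le_mul_right _ hP2
      _ = Q ^ 2 * P ^ 4 := by ring
  have h9 : 1 ≤ (Q * P) ^ 2 := Nat.pow_pos hQP
  calc _ ≤ 29 * (Q * P ^ 3) * (291 * (Q * P)) + (2 * (Q * P) * (96 * (Q * P)) + 1) :=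
        Nat.add_le_add h6 (Nat.succ_le_succ h7)
    _ = 8439 * (Q ^ 2 * P ^ 4) + (192 * (Q * P) ^ 2 + 1) := by ring
    _ ≤ _ := by omega

/-! # The embedding of the wires -/

/-- The wires other than the input bits. -/
abbrev AncillaWire (β : Type) (u : ℕ) : Type := Bool ⊕ Fin (u + 2) ⊕ β × Fin (u + 2)

/-- Wires as a disjoint union. -/
def Wire.toSum {α β : Type} {u : ℕ} : Wire α β u → α ⊕ AncillaWire β u
  | .inp i => .inl i
  | .one => .inr (.inl false)
  | .flag => .inr (.inl true)
  | .carry j => .inr (.inr (.inl j))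
  | .reg r j => .inr (.inr (.inr (r, j)))

theorem Wire.toSum_injective {α β : Type} {u : ℕ} :
    Injective (Wire.toSum : Wire α β u → α ⊕ AncillaWire β u) := by
  intro p q h
  cases p <;> cases q <;> simp_all [Wire.toSum]

theorem tensor_ket {a b : ℕ} (x : Fin a → Fin 2) (y : Fin b → Fin 2) :
    tensor (ket x) (ket y) = ket (Fin.append x y) := by
  funext z
  have key : z = Fin.append x y ↔
      (fun i => z (Fin.castAdd b i)) = x ∧ (fun j => z (Fin.natAdd a j)) = y := by
    constructor
    · rintro rfl
      exact ⟨by simp, by simp⟩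
    · rintro ⟨rfl, rfl⟩
      exact (Fin.append_castAdd_natAdd).symm
  rw [tensor, ket_apply, ket_apply, ket_apply, if_congr key rfl rfl]
  split_ifs <;> simp_all

theorem tensor_add_smul {a b : ℕ} (v : QState a) (w w' : QState b) (c c' : ℂ) :
    tensor v (c • w + c' • w') = c • tensor v w + c' • tensor v w' := by
  funext z
  simp only [tensor, Pi.add_apply, Pi.smul_apply, smul_eq_mul]
  ring

theorem rotState_eq_tensor {a A : ℕ} (y : Fin (a + (A + 1)) → Fin 2) (θ : ℝ) :
    rotState (Fin.natAdd a (Fin.last A)) y θ =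
      tensor (ket fun r => y (Fin.castAdd (A + 1) r))
        (tensor (ket fun j => y (Fin.natAdd a (Fin.castAdd 1 j)))
          (qubit (Real.cos (θ / 2) : ℂ) (Real.sin (θ / 2) : ℂ))) := by
  have key : ∀ v : Fin 2, update y (Fin.natAdd a (Fin.last A)) v =
      Fin.append (fun r => y (Fin.castAdd (A + 1) r))
        (Fin.append (fun j => y (Fin.natAdd a (Fin.castAdd 1 j))) ![v]) := by
    intro v
    funext q
    refine Fin.addCases (fun r => ?_) (fun j => ?_) q
    · rw [Fin.append_left, update_of_ne]
      intro h
      have h1 := r.isLt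
      have h2 := congrArg Fin.val h
      simp at h2
      omega
    · rw [Fin.append_right]
      refine Fin.addCases (m := A) (n := 1) (fun j => ?_) (fun j => ?_) j
      · rw [Fin.append_left, update_of_ne]
        intro h
        have h1 := j.isLt
        have h2 := congrArg Fin.val h
        simp at h2
        omega
      · rw [Fin.append_right]
        obtain rfl : j = 0 := Subsingleton.elim _ _
        exact update_self _ _ _
  rw [qubit, tensor_add_smul, tensor_add_smul, tensor_ket, tensor_ket, tensor_ket, tensor_ket,
    rotState, key, key]

end
end PayoffCircuit

/-! ### Assembly of the circuit -/

theorem proposition3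
    (d n₁ n₂ m₁ m₂ K : ℕ) (I : Fin K → ℕ)
    (hd : 1 ≤ d) (hn₁ : 1 ≤ n₁) (hn₂ : 1 ≤ n₂) (hm₁ : 1 ≤ m₁) (hm₂ : 1 ≤ m₂)
    (hK : 1 ≤ K) (hI : ∀ k, 1 ≤ I k)
    (ξ : Fin K → ℤ) (hξ : ∀ k, ξ k = -1 ∨ ξ k = 1)
    (s : ℝ) (hs : s ∈ Set.Ioo (0 : ℝ) 1)
    (a : (k : Fin K) → Fin (I k) → Fin d → PayoffCircuit.BitStr n₂ m₂)
    (b : (k : Fin K) → Fin (I k) → PayoffCircuit.BitStr n₂ m₂) :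
    ∃ (A : ℕ) (R : PayoffCircuit.Circuit (d * (n₁ + m₁) + (A + 1))),
      -- the number of qubits is `N`, and its upper bound
      ((d * (n₁ + m₁) + (A + 1) : ℕ) : ℤ) = PayoffCircuit.qubitCount d n₁ n₂ m₁ m₂ I ∧
      d * (n₁ + m₁) + (A + 1) ≤
        23 * K * Finset.univ.sup I * d * ((n₁ + n₂) + (m₁ + m₂) + 1) ∧
      -- the number of elementary gates
      R.gateCount ≤
        15262 * K ^ 3 * Finset.univ.sup I ^ 3 * d ^ 4 * ((n₁ + n₂) + (m₁ + m₂) + 1) ^ 4 ∧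
      -- the action on `|i₁⟩ ⋯ |i_d⟩ |0⟩`
      ∀ i : Fin d → PayoffCircuit.BitStr n₁ m₁, ∃ anc : Fin A → Fin 2,
        let θ : ℝ :=
          s * ((PayoffCircuit.decode (PayoffCircuit.payoffStr hd hI ξ a b i) : ℚ) : ℝ) +
            Real.pi / 2
        R.matrix.mulVec
            (PayoffCircuit.tensor (PayoffCircuit.ketRegisters i)
              (PayoffCircuit.ketZero (A + 1))) =
          PayoffCircuit.tensor (PayoffCircuit.ketRegisters i)
            (PayoffCircuit.tensor (PayoffCircuit.ket anc)
              (PayoffCircuit.qubit (Real.cos (θ / 2) : ℂ) (Real.sin (θ / 2) : ℂ))) := by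
  open PayoffCircuit in
  have hcard := card_wires_le (d := d) (n₁ := n₁) (n₂ := n₂) (m₁ := m₁) (m₂ := m₂) I hK hI
  have hcount := qubitCount_eq (n₁ := n₁) (n₂ := n₂) (m₁ := m₁) (m₂ := m₂) I hd
  have hle := qubitCount_le (n₂ := n₂) (m₂ := m₂) I hd hn₁ hm₁ hK hI
  obtain ⟨A, hA⟩ : ∃ A, ancillaCount d n₁ n₂ m₁ m₂ I = A + 1 :=
    ⟨ancillaCount d n₁ n₂ m₁ m₂ I - 1, by omega⟩
  rw [hA] at hcard hcount hle
  -- A string in F_{n+d,m} has u + 1 bits, so its scaled value lies in [-2^u, 2^u).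
  obtain ⟨u, hu⟩ : ∃ u, n₁ + n₂ + d + (m₁ + m₂) = u + 1 :=
    ⟨n₁ + n₂ + d + (m₁ + m₂) - 1, by omega⟩
  let β : Type := Σ k : Fin K, Fin (I k)
  -- Any injection into the first A ancillas will do; the qubits not hit stay idle, and the last one
  -- is kept for the rotation.
  obtain ⟨g⟩ : Nonempty (AncillaWire β u ↪ Fin A) := by
    apply Function.Embedding.nonempty_of_card_le
    simp only [β, Fintype.card_sum, Fintype.card_bool, Fintype.card_fin, Fintype.card_prod,
      Fintype.card_sigma]
    rw [show u + 2 = n₁ + n₂ + (m₁ + m₂) + d + 1 by omega]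
    omega
  let f₀ : (Fin d × Fin (n₁ + m₁)) ⊕ AncillaWire β u → Fin (d * (n₁ + m₁) + (A + 1)) :=
    Sum.elim (fun p => Fin.castAdd (A + 1) (finProdFinEquiv p))
      fun q => Fin.natAdd (d * (n₁ + m₁)) (g q).castSucc
  have hf₀ : Function.Injective f₀ := by
    refine Function.Injective.sumElim
      ((Fin.castAdd_injective _ _).comp finProdFinEquiv.injective)
      ((Fin.natAdd_injective _ _).comp ((Fin.castSucc_injective _).comp g.injective)) ?_
    intro p q h
    have h1 := (finProdFinEquiv p).isLt
    have h2 := congrArg Fin.val h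
    simp only [Fin.val_castAdd, Fin.val_natAdd] at h2
    omega
  let f : Wire (Fin d × Fin (n₁ + m₁)) β u ↪ Fin (d * (n₁ + m₁) + (A + 1)) :=
    ⟨f₀ ∘ Wire.toSum, hf₀.comp Wire.toSum_injective⟩
  let t : Fin (d * (n₁ + m₁) + (A + 1)) := Fin.natAdd (d * (n₁ + m₁)) (Fin.last A)
  have ht : t ∉ Set.range f := by
    rintro ⟨q, hq⟩
    have h2 : (f₀ q.toSum).val = d * (n₁ + m₁) + A := congrArg Fin.val hq
    generalize q.toSum = z at h2
    rcases z with p | z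
    · have h1 := (finProdFinEquiv p).isLt
      simp only [f₀, Sum.elim_inl, Fin.val_castAdd] at h2
      omega
    · have h1 := (g z).isLt
      simp only [f₀, Sum.elim_inr, Fin.val_natAdd, Fin.val_castSucc] at h2
      omega
  -- The coefficient of bit p.2 of the input p.1 is the scaled a_{k,l,j} times the scaled weight of
  -- that bit. The division by 2^m in the angle factor undoes the scaling.
  obtain ⟨R, hR1, hR2⟩ := exists_circuit_payoff (u := u) hI
    (fun r (p : Fin d × Fin (n₁ + m₁)) => intDecode (a r.1 r.2 p.1) * intWeight n₁ m₁ p.2)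
    (fun r => intDecode (b r.1 r.2) * 2 ^ m₁) (fun k => s * ξ k / 2 ^ (m₁ + m₂)) f t ht
  refine ⟨A, R, hcount, hle, hR1.trans ?_, fun i => ?_⟩
  · obtain ⟨e, rfl⟩ : ∃ e, d = e + 1 := ⟨d - 1, by omega⟩
    set L := (n₁ + n₂) + (m₁ + m₂) + 1 with hL
    set J := Finset.univ.sup I with hJ
    have hJ1 : 1 ≤ J :=
      (hI ⟨0, hK⟩).trans (Finset.le_sup (f := I) (Finset.mem_univ _))
    have hQ : 1 ≤ K * J := Nat.mul_pos hK hJ1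
    -- All four widths are at least 1, so L = n + m + 1 is at least 5.
    have heL : e * 5 ≤ e * L := Nat.mul_le_mul_left _ (by omega)
    have hP : (e + 1) * L = e * L + L := by ring
    have hc : Fintype.card (Fin (e + 1) × Fin (n₁ + m₁)) + 3 * (e + 1) ≤ e * L + L := by
      rw [Fintype.card_prod, Fintype.card_fin, Fintype.card_fin, ← hP]
      calc (e + 1) * (n₁ + m₁) + 3 * (e + 1) = (e + 1) * (n₁ + m₁ + 3) := by ring
        _ ≤ (e + 1) * L := Nat.mul_le_mul_left _ (by omega)
    refine (gateCount_bound (P := (e + 1) * L) (Q := K * J) (by omega) hQ (by omega) (by omega)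
      (hle.trans_eq (by ring)) rfl hJ1).trans ?_
    calc 15262 * ((K * J) ^ 2 * ((e + 1) * L) ^ 4)
        ≤ 15262 * ((K * J) ^ 3 * ((e + 1) * L) ^ 4) :=
          Nat.mul_le_mul_left _ (Nat.mul_le_mul_right _ (Nat.pow_le_pow_right hQ (by norm_num)))
      _ = _ := by ring
  · let y : Fin (d * (n₁ + m₁) + (A + 1)) → Fin 2 :=
      Fin.append (fun r => i (finProdFinEquiv.symm r).1 (finProdFinEquiv.symm r).2) fun _ => 0
    have hy : ∀ p : Fin d × Fin (n₁ + m₁), y (f (.inp p)) = i p.1 p.2 := by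
      intro p
      change y (Fin.castAdd (A + 1) (finProdFinEquiv p)) = _
      simp only [y, Fin.append_left, Equiv.symm_apply_apply]
    have hform : ∀ r : β, affineForm
        (fun p : Fin d × Fin (n₁ + m₁) => intDecode (a r.1 r.2 p.1) * intWeight n₁ m₁ p.2)
        (intDecode (b r.1 r.2) * 2 ^ m₁) (fun p => y (f (.inp p))) =
        intDecode (affineStr hd (a r.1 r.2) (b r.1 r.2) i) := by
      intro r
      rw [intDecode_affineStr hd hn₁ hn₂, affineForm, Fintype.sum_prod_type]
      congr 1
      refine Finset.sum_congr rfl fun j _ => ?_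
      rw [show intDecode (i j) = ∑ t, ((i j t).val : ℤ) * intWeight n₁ m₁ t from rfl,
        Finset.mul_sum]
      refine Finset.sum_congr rfl fun l _ => ?_
      rw [hy]
      ring
    obtain ⟨y', v, e1, e2, e3⟩ := hR2 y
      (fun q hq => by
        have : ∃ z, f q = Fin.natAdd (d * (n₁ + m₁)) z := by
          cases q with
          | inp p => exact absurd rfl (hq p)
          | _ => exact ⟨_, rfl⟩
        obtain ⟨z, hz⟩ := this
        rw [hz]
        simp only [y, Fin.append_right])
      (by simp only [y, t, Fin.append_right])
      (fun r => by
        rw [hform r]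
        -- The range condition comes from the format of `affineStr`, without estimating the
        -- coefficients.
        have := intDecode_mem (by omega) (affineStr hd (a r.1 r.2) (b r.1 r.2) i)
        rwa [hu, Nat.add_sub_cancel] at this)
    refine ⟨fun j => y' (Fin.natAdd _ (Fin.castAdd 1 j)), ?_⟩
    intro θ
    have hθ : ∑ k, s * ξ k / 2 ^ (m₁ + m₂) * (v k : ℝ) + Real.pi / 2 = θ := by
      simp only [θ]
      rw [decode_payoffStr hd hK hI ξ hξ, Rat.cast_sum, Finset.mul_sum]
      congr 1
      refine Finset.sum_congr rfl fun k _ => ?_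
      have h1 := intDecode_maxStr_eq (by omega) (hI k)
        (fun l => affineStr hd (a k l) (b k l) i) (v := v k)
        (fun l => by rw [← hform ⟨k, l⟩]; exact (e3 k).1 l)
        (by
          obtain ⟨l, hl⟩ := (e3 k).2
          exact ⟨l, by rw [← hform ⟨k, l⟩]; exact hl⟩)
      have h2 : (v k : ℝ) = ((decode (maxStr (hI k) fun l => affineStr hd (a k l) (b k l) i) : ℚ) :
          ℝ) * 2 ^ (m₁ + m₂) := by
        rw [← Rat.cast_intCast, ← h1]
        push_cast
        ring
      rw [h2]
      push_cast
      field_simp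
    have hin : ketRegisters i = ket fun r => y' (Fin.castAdd (A + 1) r) := by
      rw [ketRegisters]
      congr 1
      funext r
      have := (e2 (finProdFinEquiv.symm r)).trans (hy _)
      change y' (Fin.castAdd (A + 1) (finProdFinEquiv (finProdFinEquiv.symm r))) = _ at this
      rw [Equiv.apply_symm_apply] at this
      exact this.symm
    have hstart : tensor (ketRegisters i) (ketZero (A + 1)) = ket y := by
      rw [ketRegisters, ketZero, tensor_ket]
    rw [hstart, e1, rotState_eq_tensor, hθ, hin]
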